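/- Let $n\in\mathbb N$ and $\beta>0$. "Measure" means a finite nonnegative Borel measure; $\mathrm{spt}$ denotes its support. For an ensemble of trajectories $x(\cdot\mid x_0)$, a function $w:\mathbb R^n\to\mathbb R$, and a Borel family (Markov kernel) $x_0\mapsto\tau_{x_0}$ of probability measures on $[0,\infty]$, the time integral $\int_0^{s}\cdots\,dt$ runs over the finite times $0\le t\le s$ (so over $[0,\infty)$ if $s=\infty$), and $e^{-\beta s}w(x(s\mid x_0)):=0$ for $s=\infty$. (1) General form. Let $\bar f:\mathbb R^n\to\mathbb R^n$ be globally Lipschitz and let $\mu_0,\mu,\mu_T$ be measures on $\mathbb R^n$ satisfying the discounted Liouville equation $$\int v\,d\mu_T=\int v\,d\mu_0+\int(\nabla v\cdot\bar f-\beta v)\,d\mu\qquad\text{for all compactly supported } v\in C^1(\mathbb R^n).$$ Then there exist a Borel family $\{\tau_{x_0}\}_{x_0\in\mathbb R^n}$ of probability measures on $[0,\infty]$ and trajectories $x(\cdot\mid x_0):[0,\infty)\to\mathbb R^n$ of $\dot x=\bar f(x)$ with $x(0\mid x_0)=x_0$ for every $x_0\in\mathbb R^n$, such that $$\int v\,d\mu_0=\int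 v(x(0\mid x_0))\,d\mu_0(x_0)\quad\forall v\in L^1(\mu_0),$$ $$\int v\,d\mu=\int\int_{[0,\infty]}\int_0^{s}e^{-\beta t}v(x(t\mid x_0))\,dt\,d\tau_{x_0}(s)\,d\mu_0(x_0)\quad\forall v\in L^1(\mu),$$ $$\int v\,d\mu_T=\int\int_{[0,\infty]}e^{-\beta s}v(x(s\mid x_0))\,d\tau_{x_0}(s)\,d\mu_0(x_0)\quad\forall v\in L^1(\mu_T).$$ (2) Control version. Let $f,f_{u_1},\dots,f_{u_m}:\mathbb R^n\to\mathbb R^n$ be polynomial vector fields, let $X=\{x\in\mathbb R^n: g_j(x)\ge0,\ j=1,\dots,k\}$ be compact with polynomials $g_j$, let $U=[0,\bar u]^m$, and let $u:X\to U$ be Lipschitz. Let $\mu_0,\mu,\mu_T$ be measures on $\mathbb R^n$ with supports contained in $X$, put $d\nu_i=u_i\,d\mu$, and suppose that $$\int v\,d\mu_T=\int v\,d\mu_0+\int(\nabla v\cdot f-\beta v)\,d\mu+\sum_{i=1}^m\int\nabla v\cdot f_{u_i}\,d\nu_i\qquad\text{for all } v\in C^1(\mathbb R^n).$$ Then there exist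 a Borel family $\{\tau_{x_0}\}$ of probability measures on $[0,\infty]$ and curves $x(\cdot\mid x_0)$ with $x(0\mid x_0)=x_0$ such that for every $x_0\in X$ and every $s\in\mathrm{spt}\,\tau_{x_0}$ the curve $x(\cdot\mid x_0)$ solves $$\dot x(t)=f(x(t))+\sum_{i=1}^m f_{u_i}(x(t))\,u_i(x(t))$$ and satisfies $x(t\mid x_0)\in X$ at all finite times $0\le t\le s$ (in particular at $t=s$ if $s<\infty$). Moreover the three identities of (1) hold, and for $i=1,\dots,m$ $$\int v\,d\nu_i=\int\int_{[0,\infty]}\int_0^{s}e^{-\beta t}v(x(t\mid x_0))\,u_i(x(t\mid x_0))\,dt\,d\tau_{x_0}(s)\,d\mu_0(x_0)\quad\forall v\in L^1(\nu_i).$$ -/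

import Mathlib

open MeasureTheory ProbabilityTheory Set
open scoped ENNReal NNReal

noncomputable section

/-- The state space `ℝⁿ` with its Euclidean norm. -/
abbrev State (n : ℕ) : Type := EuclideanSpace ℝ (Fin n)

/-- The vector field on `ℝⁿ` whose components are the given polynomials. -/
def polyField {n : ℕ} (p : Fin n → MvPolynomial (Fin n) ℝ) (x : State n) : State n :=
  WithLp.toLp 2 fun k => MvPolynomial.eval (fun j => x j) (p k)

/-- The basic closed semialgebraic set `{x | g_j(x) ≥ 0 for all j}`. -/
def semialgSet {n k : ℕ} (g : Fin k → MvPolynomial (Fin n) ℝ) : Set (State n) :=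
  {x | ∀ j, 0 ≤ MvPolynomial.eval (fun l => x l) (g j)}

/-- The input box `[0, ubar]^m`. -/
def inputBox (m : ℕ) (ubar : ℝ) : Set (EuclideanSpace ℝ (Fin m)) :=
  {w | ∀ i, w i ∈ Icc 0 ubar}

/-- The closed-loop vector field `x ↦ f(x) + ∑ᵢ f_{uᵢ}(x) uᵢ(x)`. -/
def closedLoop {n m : ℕ} (f : Fin n → MvPolynomial (Fin n) ℝ)
    (fu : Fin m → Fin n → MvPolynomial (Fin n) ℝ)
    (u : State n → EuclideanSpace ℝ (Fin m)) (x : State n) : State n :=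
  polyField f x + ∑ i, u x i • polyField (fu i) x

/-- The finite times `t ≥ 0` with `t ≤ s`, where `s ∈ [0,∞]`; this is `[0,∞)` for `s = ∞`. -/
def timesUpTo (s : ℝ≥0∞) : Set ℝ := {t | 0 ≤ t ∧ ENNReal.ofReal t ≤ s}

/-- `y` solves `y' = F(y)`, `y(0) = x₀`, on the finite times up to `s ∈ [0,∞]`
(with one-sided derivatives at the end points). -/
def IsTrajectoryUpTo {n : ℕ} (F : State n → State n) (x₀ : State n) (s : ℝ≥0∞)
    (y : ℝ → State n) : Prop :=
  y 0 = x₀ ∧ ∀ t ∈ timesUpTo s, HasDerivWithinAt y (F (y t)) (timesUpTo s) t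

/-- `∫ ∫_{[0,∞]} ∫_0^s e^{-βt} w(x(t|x₀)) dt dτ_{x₀}(s) dμ₀(x₀)`. -/
def occupationIntegral {n : ℕ} (β : ℝ) (μ₀ : Measure (State n)) (τ : Kernel (State n) ℝ≥0∞)
    (x : State n → ℝ → State n) (w : State n → ℝ) : ℝ :=
  ∫ x₀, (∫ s, (∫ t in timesUpTo s, Real.exp (-β * t) * w (x x₀ t)) ∂(τ x₀)) ∂μ₀

/-- `e^{-βs} w(y(s))` for a stopping time `s ∈ [0,∞]`, which is `0` at `s = ∞`. -/
def discountedTerminal {n : ℕ} (β : ℝ) (w : State n → ℝ) (y : ℝ → State n) (s : ℝ≥0∞) : ℝ :=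
  if s = ∞ then 0 else Real.exp (-β * s.toReal) * w (y s.toReal)

/-- `∫ ∫_{[0,∞]} e^{-βs} w(x(s|x₀)) dτ_{x₀}(s) dμ₀(x₀)`. -/
def terminalIntegral {n : ℕ} (β : ℝ) (μ₀ : Measure (State n)) (τ : Kernel (State n) ℝ≥0∞)
    (x : State n → ℝ → State n) (w : State n → ℝ) : ℝ :=
  ∫ x₀, (∫ s, discountedTerminal β w (x x₀) s ∂(τ x₀)) ∂μ₀

end

open Filter Topology
open scoped BoundedContinuousFunction

/-! ### Global flow of a Lipschitz vector field. -/

section GlobalFlow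

variable {E : Type*} [NormedAddCommGroup E] [NormedSpace ℝ E]

/-! The trajectories are those of the global flow `Φ` of the Lipschitz field, so only the stopping
law has to be found. Let `R m` be the discounted occupation measure of the flow started from `m` and
never stopped.

The Liouville equation first extends, by mollification, to compactly supported Lipschitz functions
with a continuous derivative along the flow (`liouville_of_lipschitz`). Testing it on `∫₀ᵀ e^{-βt}
v(Φ_t x) dt` and letting `T → ∞` yields `μ + R μT = R μ₀`
(`add_resolvent_eq_resolvent_of_liouville`). In particular `R μT ≤ R μ₀`, and hence `∫ w dμT ≤ ∫ w
dμ₀` for every bounded continuous excessive `w`, that is, `e^{-βt} w(Φ_t x) ≤ w(x)` for `t ≥ 0`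
(`Flow.integral_le_of_excessive`).

The value function `x ↦ sup_s e^{-βs} v(Φ_s x)` of the optimal stopping problem is excessive and
dominates `v`. Therefore `∫ v dμT ≤ ∫ sup_s e^{-βs} v(Φ_s x) dμ₀`, which is exactly the domination
that Hahn–Banach needs: the functional sending `e^{-βs} v(Φ_s x)` to `∫ v dμT` extends to all
bounded continuous functions of `(x, s)`. By Riesz it is a measure `σ` on `ℝⁿ × [0,∞]` with first
marginal `μ₀` and discounted terminal law `μT` (`Flow.exists_stopping_measure`). Compactness of
`[0,∞]` and the discount, which makes the payoff vanish continuously at `s = ∞`, are essential here.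

The strong Markov identity gives `occ σ + R μT = R μ₀`. Cancelling the finite measure `R μT` leaves
`occ σ = μ`, and the disintegration of `σ` over `μ₀` is `τ` (`Flow.exists_stopping_kernel`).

For the control version the closed loop on the compact set `X` is extended to a global Lipschitz
field. Since `μ` does not charge the complement of `X`, almost every stopped trajectory stays in
`X`; continuity and closedness extend this to all times up to any `s` in the support of its stopping
law (`forall_mem_of_ae_timesUpTo`), and `τ` is altered on a `μ₀`-null set. -/

lemma norm_intervalIntegral_le_of_norm_le_exp_abs {g : ℝ → E} {C l : ℝ} (hl : 0 < l)
    (hg : ∀ r, ‖g r‖ ≤ C * Real.exp (l * |r|)) (t : ℝ) :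
    ‖∫ r in (0 : ℝ)..t, g r‖ ≤ C / l * Real.exp (l * |t|) := by
  have key : ∀ (g : ℝ → E), (∀ r, ‖g r‖ ≤ C * Real.exp (l * |r|)) → ∀ t : ℝ, 0 ≤ t →
      ‖∫ r in (0 : ℝ)..t, g r‖ ≤ C / l * Real.exp (l * |t|) := by
    intro g hg t ht
    have hC : 0 ≤ C := by simpa using (norm_nonneg _).trans (hg 0)
    have hd : ∀ r : ℝ, HasDerivAt (fun r => C / l * Real.exp (l * r)) (C * Real.exp (l * r)) r := by
      intro r
      have := (((hasDerivAt_id r).const_mul l).exp).const_mul (C / l)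
      refine this.congr_deriv ?_
      simp
      field_simp
    have hintv : ∫ r in (0 : ℝ)..t, C * Real.exp (l * r) =
        C / l * Real.exp (l * t) - C / l * Real.exp (l * 0) :=
      intervalIntegral.integral_eq_sub_of_hasDerivAt (fun r _ => hd r)
        (Continuous.intervalIntegrable (by fun_prop) _ _)
    calc ‖∫ r in (0 : ℝ)..t, g r‖ ≤ ∫ r in (0 : ℝ)..t, C * Real.exp (l * r) := by
          refine intervalIntegral.norm_integral_le_of_norm_le ht ?_
            (Continuous.intervalIntegrable (by fun_prop) _ _)
          refine Eventually.of_forall fun r hr => ?_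
          simpa [abs_of_pos hr.1] using hg r
      _ ≤ C / l * Real.exp (l * |t|) := by
          rw [hintv, abs_of_nonneg ht]
          have : 0 ≤ C / l * Real.exp (l * 0) := by positivity
          linarith
  rcases le_total 0 t with ht | ht
  · exact key g hg t ht
  · have h := key (fun r => g (-r)) (fun r => by simpa using hg (-r)) (-t) (by linarith)
    rw [intervalIntegral.integral_comp_neg] at h
    rw [intervalIntegral.integral_symm, norm_neg]
    simpa using h

/-- A globally Lipschitz autonomous ODE has a global solution from every initial point. -/
theorem LipschitzWith.exists_global_solution [CompleteSpace E] {K : ℝ≥0} {F : E → E} (hF : LipschitzWith K F)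
    (x₀ : E) : ∃ y : ℝ → E, y 0 = x₀ ∧ ∀ t, HasDerivAt y (F (y t)) t := by
  -- Solutions are sought as `x₀ + e^{l|t|} z(t)` with `z` bounded. In this weighted norm the Picard
  -- map contracts by `K / l = K / (K + 1) < 1` on the whole line, so no gluing of local solutions
  -- is needed.
  set l : ℝ := K + 1 with hl
  have hl0 : 0 < l := by positivity
  have hFc := hF.continuous
  have hcont : ∀ z : ℝ →ᵇ E, Continuous fun r => F (x₀ + Real.exp (l * |r|) • z r) := by
    intro z
    have := z.continuous
    fun_prop
  have hbd : ∀ z : ℝ →ᵇ E, ∀ r, ‖F (x₀ + Real.exp (l * |r|) • z r)‖ ≤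
      (‖F x₀‖ + K * ‖z‖) * Real.exp (l * |r|) := by
    intro z r
    have h1 : ‖F (x₀ + Real.exp (l * |r|) • z r) - F x₀‖ ≤ K * (Real.exp (l * |r|) * ‖z‖) := by
      refine (hF.norm_sub_le _ _).trans ?_
      rw [add_sub_cancel_left, norm_smul, Real.norm_of_nonneg (Real.exp_pos _).le]
      gcongr
      exact z.norm_coe_le_norm r
    have h2 : 1 ≤ Real.exp (l * |r|) := Real.one_le_exp (by positivity)
    have h3 := norm_le_norm_add_norm_sub' (F (x₀ + Real.exp (l * |r|) • z r)) (F x₀)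
    nlinarith [norm_nonneg (F x₀)]
  let P : (ℝ →ᵇ E) → (ℝ →ᵇ E) := fun z => BoundedContinuousFunction.ofNormedAddCommGroup
    (fun t => Real.exp (-(l * |t|)) • ∫ r in (0 : ℝ)..t, F (x₀ + Real.exp (l * |r|) • z r))
    (by
      have := intervalIntegral.continuous_primitive
        (μ := volume) (fun a b => (hcont z).intervalIntegrable a b) 0
      fun_prop)
    ((‖F x₀‖ + K * ‖z‖) / l)
    (fun t => by
      have h := norm_intervalIntegral_le_of_norm_le_exp_abs hl0 (hbd z) t
      rw [norm_smul, Real.norm_of_nonneg (Real.exp_pos _).le]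
      calc _ ≤ Real.exp (-(l * |t|)) * ((‖F x₀‖ + K * ‖z‖) / l * Real.exp (l * |t|)) := by gcongr
        _ = _ := by rw [mul_left_comm, ← Real.exp_add]; simp)
  have hP : ContractingWith (K / (K + 1)) P := by
    refine ⟨?_, LipschitzWith.of_dist_le_mul fun z z' => ?_⟩
    · rw [div_lt_one (by positivity)]
      exact lt_add_one K
    · refine (BoundedContinuousFunction.dist_le (by positivity)).2 fun t => ?_
      have h := norm_intervalIntegral_le_of_norm_le_exp_abs (C := K * dist z z') hl0
        (g := fun r => F (x₀ + Real.exp (l * |r|) • z r) - F (x₀ + Real.exp (l * |r|) • z' r))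
        (fun r => by
          refine (hF.norm_sub_le _ _).trans ?_
          rw [add_sub_add_left_eq_sub, ← smul_sub, norm_smul,
            Real.norm_of_nonneg (Real.exp_pos _).le, ← dist_eq_norm, mul_assoc,
            mul_comm (dist z z')]
          gcongr
          exact z.dist_coe_le_dist r) t
      rw [intervalIntegral.integral_sub ((hcont z).intervalIntegrable _ _)
        ((hcont z').intervalIntegrable _ _)] at h
      simp only [P, BoundedContinuousFunction.coe_ofNormedAddCommGroup]
      rw [dist_eq_norm, ← smul_sub, norm_smul, Real.norm_of_nonneg (Real.exp_pos _).le]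
      calc _ ≤ Real.exp (-(l * |t|)) * (K * dist z z' / l * Real.exp (l * |t|)) := by gcongr
        _ = K * dist z z' / l := by rw [mul_left_comm, ← Real.exp_add]; simp
        _ = _ := by push_cast; ring
  obtain ⟨z, hz⟩ : ∃ z, P z = z := ⟨_, hP.fixedPoint_isFixedPt⟩
  have hy : ∀ t, x₀ + Real.exp (l * |t|) • z t =
      x₀ + ∫ r in (0 : ℝ)..t, F (x₀ + Real.exp (l * |r|) • z r) := by
    intro t
    have h1 : z t = Real.exp (-(l * |t|)) •
        ∫ r in (0 : ℝ)..t, F (x₀ + Real.exp (l * |r|) • z r) :=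
      congrArg (fun w : ℝ →ᵇ E => w t) hz.symm
    nth_rewrite 1 [h1]
    rw [smul_smul, ← Real.exp_add]
    simp
  refine ⟨fun t => x₀ + Real.exp (l * |t|) • z t, ?_, fun t => ?_⟩
  · simpa using hy 0
  · have h1 : HasDerivAt (fun t => ∫ r in (0 : ℝ)..t, F (x₀ + Real.exp (l * |r|) • z r))
        (F (x₀ + Real.exp (l * |t|) • z t)) t :=
      intervalIntegral.integral_hasDerivAt_right ((hcont z).intervalIntegrable _ _)
        (hcont z).aestronglyMeasurable.stronglyMeasurableAtFilter (hcont z).continuousAt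
    simpa only [← hy] using h1.const_add x₀

/-- Grönwall forward in time; negative times follow by time reversal, since `-F` has the same
Lipschitz constant. -/
lemma dist_le_of_global_solutions {K : ℝ≥0} {F : E → E} (hF : LipschitzWith K F) {y z : ℝ → E}
    (hy : ∀ t, HasDerivAt y (F (y t)) t) (hz : ∀ t, HasDerivAt z (F (z t)) t) (t : ℝ) :
    dist (y t) (z t) ≤ dist (y 0) (z 0) * Real.exp (K * |t|) := by
  have key : ∀ {F : E → E} (_ : LipschitzWith K F) {y z : ℝ → E}
      (_ : ∀ t, HasDerivAt y (F (y t)) t) (_ : ∀ t, HasDerivAt z (F (z t)) t) (t : ℝ), 0 ≤ t →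
      dist (y t) (z t) ≤ dist (y 0) (z 0) * Real.exp (K * |t|) := by
    intro F hF y z hy hz t ht
    have := dist_le_of_trajectories_ODE (v := fun _ => F) (a := 0) (b := t) (fun _ => hF)
      (fun s _ => (hy s).continuousAt.continuousWithinAt) (fun s _ => (hy s).hasDerivWithinAt)
      (fun s _ => (hz s).continuousAt.continuousWithinAt) (fun s _ => (hz s).hasDerivWithinAt)
      le_rfl t (right_mem_Icc.2 ht)
    simpa [abs_of_nonneg ht] using this
  rcases le_total 0 t with ht | ht
  · exact key hF hy hz t ht
  · have hneg : ∀ {y : ℝ → E}, (∀ t, HasDerivAt y (F (y t)) t) →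
        ∀ t, HasDerivAt (fun s => y (-s)) (-F (y (-t))) t := by
      intro y hy t
      simpa [Function.comp_def] using (hy (-t)).scomp t (hasDerivAt_neg t)
    have := key (F := fun x => -F x) hF.neg (hneg hy) (hneg hz) (-t) (by linarith)
    simpa using this

/-- The flow of a globally Lipschitz vector field. -/
theorem LipschitzWith.exists_flow [CompleteSpace E] {K : ℝ≥0} {F : E → E} (hF : LipschitzWith K F) :
    ∃ Φ : Flow ℝ E, (∀ x t, HasDerivAt (fun s => Φ s x) (F (Φ t x)) t) ∧
      ∀ t x y, dist (Φ t x) (Φ t y) ≤ dist x y * Real.exp (K * |t|) := by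
  choose y hy0 hy using hF.exists_global_solution
  have hLip : ∀ t a b, dist (y a t) (y b t) ≤ dist a b * Real.exp (K * |t|) := by
    intro t a b
    simpa [hy0] using dist_le_of_global_solutions hF (hy a) (hy b) t
  have hadd : ∀ t s a, y a (t + s) = y (y a s) t := by
    intro t s a
    have h := dist_le_of_global_solutions hF (y := fun t => y a (t + s)) (z := y (y a s))
      (fun t => (hy a (t + s)).comp_add_const t s) (hy _) t
    simpa [hy0] using h
  refine ⟨⟨fun t x => y x t, ?_, fun t s a => hadd t s a, hy0⟩, fun x t => hy x t, hLip⟩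
  refine continuous_iff_continuousAt.2 fun ⟨t, x⟩ => ?_
  rw [ContinuousAt, tendsto_iff_dist_tendsto_zero]
  have hlim : Tendsto (fun p : ℝ × E => dist p.2 x * Real.exp (K * |p.1|) + dist (y x p.1) (y x t))
      (𝓝 (t, x)) (𝓝 0) := by
    have hc : Continuous (y x) := continuous_iff_continuousAt.2 fun s => (hy x s).continuousAt
    have : Continuous fun p : ℝ × E =>
        dist p.2 x * Real.exp (K * |p.1|) + dist (y x p.1) (y x t) := by fun_prop
    simpa using this.tendsto (t, x)
  refine squeeze_zero (fun _ => dist_nonneg) (fun p => ?_) hlim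
  exact (dist_triangle _ (y x p.1) _).trans (add_le_add_left (hLip _ _ _) _)

end GlobalFlow

/-! ### Extending the Liouville equation to Lipschitz test functions. -/

section Mollification

open scoped Convolution
open ContinuousLinearMap Metric

lemma Flow.hasDerivAt_of_hasDerivAt_zero {X : Type*} [TopologicalSpace X] (Φ : Flow ℝ X) {w D : X → ℝ}
    (hD : ∀ x, HasDerivAt (fun t => w (Φ t x)) (D x) 0) (x : X) (t : ℝ) :
    HasDerivAt (fun s => w (Φ s x)) (D (Φ t x)) t := by
  have h := hD (Φ t x)
  rw [← sub_self t] at h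
  have h' := h.comp_sub_const t t
  simpa [← Φ.map_add] using h'

variable {E : Type*} [NormedAddCommGroup E] [NormedSpace ℝ E]

/-- A Lipschitz function with a continuous derivative along the flow of `F` is strictly
differentiable from the right in the direction `F x`. -/
lemma Flow.exists_abs_sub_sub_le (Φ : Flow ℝ E) {F : E → E} (hF : Continuous F)
    (hΦ : ∀ x t, HasDerivAt (fun s => Φ s x) (F (Φ t x)) t) {L : ℝ≥0} {w D : E → ℝ}
    (hw : LipschitzWith L w) (hDc : Continuous D)
    (hD : ∀ x, HasDerivAt (fun t => w (Φ t x)) (D x) 0) (x : E) {η : ℝ} (hη : 0 < η) :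
    ∃ δ > 0, ∀ y ∈ ball x δ, ∀ h ∈ Ioo 0 δ, |w (y + h • F x) - w y - h * D x| ≤ η * h := by
  -- Two errors are added at the end: `L ε h` for replacing the flow by the straight line and `ε h`
  -- for the increment of `w` along the flow.
  set ε : ℝ := η / (L + 1) with hε
  have hε0 : 0 < ε := by positivity
  have hc1 : Continuous fun p : ℝ × E => D (Φ p.1 p.2) := by fun_prop
  have hc2 : Continuous fun p : ℝ × E => F (Φ p.1 p.2) := by fun_prop
  have h1 : ∀ᶠ p : ℝ × E in 𝓝 (0, x), dist (D (Φ p.1 p.2)) (D x) < ε := by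
    have := hc1.tendsto (0, x)
    simp only [Φ.map_zero_apply] at this
    exact Metric.tendsto_nhds.1 this ε hε0
  have h2 : ∀ᶠ p : ℝ × E in 𝓝 (0, x), dist (F (Φ p.1 p.2)) (F x) < ε := by
    have := hc2.tendsto (0, x)
    simp only [Φ.map_zero_apply] at this
    exact Metric.tendsto_nhds.1 this ε hε0
  obtain ⟨δ, hδ, hball⟩ := Metric.eventually_nhds_iff.1 (h1.and h2)
  have hnear : ∀ y ∈ ball x δ, ∀ h ∈ Ioo 0 δ, ∀ t ∈ Icc 0 h,
      dist (D (Φ t y)) (D x) < ε ∧ dist (F (Φ t y)) (F x) < ε := by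
    intro y hy h hh t ht
    refine @hball (t, y) ?_
    rw [Prod.dist_eq]
    refine max_lt ?_ hy
    simp only [dist_zero_right, Real.norm_eq_abs, abs_of_nonneg ht.1]
    exact ht.2.trans_lt hh.2
  refine ⟨δ, hδ, fun y hy h hh => ?_⟩
  have A : ‖(Φ h y - h • F x) - (Φ 0 y - (0 : ℝ) • F x)‖ ≤ ε * (h - 0) := by
    refine norm_image_sub_le_of_norm_deriv_le_segment' (f := fun t => Φ t y - t • F x)
      (f' := fun t => F (Φ t y) - (1 : ℝ) • F x)
      (fun t _ => ((hΦ y t).sub ((hasDerivAt_id t).smul_const (F x))).hasDerivWithinAt)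
      (fun t ht => ?_) h (right_mem_Icc.2 hh.1.le)
    have := (hnear y hy h hh t ⟨ht.1, ht.2.le⟩).2.le
    rwa [one_smul, ← dist_eq_norm]
  have B : ‖(w (Φ h y) - h • D x) - (w (Φ 0 y) - (0 : ℝ) • D x)‖ ≤ ε * (h - 0) := by
    refine norm_image_sub_le_of_norm_deriv_le_segment' (f := fun t => w (Φ t y) - t • D x)
      (f' := fun t => D (Φ t y) - (1 : ℝ) • D x)
      (fun t _ => ((Φ.hasDerivAt_of_hasDerivAt_zero hD y t).sub
        ((hasDerivAt_id t).smul_const (D x))).hasDerivWithinAt)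
      (fun t ht => ?_) h (right_mem_Icc.2 hh.1.le)
    have := (hnear y hy h hh t ⟨ht.1, ht.2.le⟩).1.le
    rwa [one_smul, ← dist_eq_norm]
  simp only [Φ.map_zero_apply, zero_smul, zero_mul, sub_zero, smul_eq_mul] at A B
  have C : |w (y + h • F x) - w (Φ h y)| ≤ L * (ε * h) := by
    have h1 := hw.norm_sub_le (y + h • F x) (Φ h y)
    have h2 : ‖y + h • F x - Φ h y‖ = ‖Φ h y - h • F x - y‖ := by
      rw [← norm_neg]; congr 1; abel
    rw [h2] at h1
    exact h1.trans (by gcongr)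
  rw [Real.norm_eq_abs] at B
  calc |w (y + h • F x) - w y - h * D x|
      = |(w (y + h • F x) - w (Φ h y)) + (w (Φ h y) - h * D x - w y)| := by congr 1; ring
    _ ≤ L * (ε * h) + ε * h := (abs_add_le _ _).trans (add_le_add C B)
    _ = η * h := by rw [hε]; field_simp

variable [FiniteDimensional ℝ E] [MeasurableSpace E] [BorelSpace E]

lemma ContDiffBump.contDiff_normed_convolution (φ : ContDiffBump (0 : E)) {w : E → ℝ}
    (hw : Continuous w) :
    ContDiff ℝ 1 (φ.normed Measure.addHaar ⋆[lsmul ℝ ℝ, Measure.addHaar] w) :=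
  φ.hasCompactSupport_normed.contDiff_convolution_left _ φ.contDiff_normed
    hw.locallyIntegrable

/-- Difference quotients of a mollification are averages of difference quotients of `w` over a ball
of radius `φ.rOut`, so a bound uniform over that ball survives averaging and the limit `t → 0⁺`. -/
lemma ContDiffBump.abs_fderiv_normed_convolution_sub_le (φ : ContDiffBump (0 : E)) {w : E → ℝ}
    (hw : Continuous w) {x e : E} {c η δ : ℝ} (hη : 0 ≤ η) (hδ : 0 < δ)
    (h : ∀ y ∈ ball x φ.rOut, ∀ t ∈ Ioo 0 δ, |w (y + t • e) - w y - t * c| ≤ η * t) :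
    |fderiv ℝ (φ.normed Measure.addHaar ⋆[lsmul ℝ ℝ, Measure.addHaar] w) x e - c| ≤ η := by
  set g := φ.normed Measure.addHaar ⋆[lsmul ℝ ℝ, Measure.addHaar] w with hg
  have hgd : DifferentiableAt ℝ g x :=
    (φ.contDiff_normed_convolution hw).differentiable one_ne_zero x
  have hex : ConvolutionExists (φ.normed Measure.addHaar) w (lsmul ℝ ℝ) Measure.addHaar :=
    φ.hasCompactSupport_normed.convolutionExists_left _ φ.continuous_normed
      hw.locallyIntegrable
  have hdiff : ∀ t ∈ Ioo 0 δ, |t⁻¹ * (g (x + t • e) - g x) - c| ≤ η := by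
    intro t ht
    have h1 : g (x + t • e) - g x = (φ.normed Measure.addHaar ⋆[lsmul ℝ ℝ, Measure.addHaar]
        fun y => w (y + t • e) - w y) x := by
      rw [hg, convolution_def, convolution_def, convolution_def, ← integral_sub (hex _) (hex _)]
      refine integral_congr_ae (Eventually.of_forall fun z => ?_)
      simp only [lsmul_apply, smul_eq_mul]
      rw [mul_sub, sub_add_eq_add_sub]
    have h2 := dist_convolution_le (μ := (Measure.addHaar : Measure E)) (x₀ := x) (z₀ := t * c)
      (ε := η * t) (R := φ.rOut) (f := φ.normed Measure.addHaar)
      (g := fun y => w (y + t • e) - w y) (mul_nonneg hη ht.1.le)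
      (by rw [φ.support_normed_eq]) φ.nonneg_normed φ.integral_normed
      (by exact (Continuous.aestronglyMeasurable (by fun_prop)))
      (fun y hy => by rw [Real.dist_eq]; exact h y hy t ht)
    rw [← h1, Real.dist_eq] at h2
    have h3 : t⁻¹ * (g (x + t • e) - g x) - c = t⁻¹ * (g (x + t • e) - g x - t * c) := by
      have := ht.1.ne'
      field_simp
    rw [h3, abs_mul, abs_of_pos (inv_pos.2 ht.1), inv_mul_le_iff₀ ht.1]
    exact h2.trans_eq (mul_comm _ _)
  have hder : HasDerivAt (fun t : ℝ => g (x + t • e)) (fderiv ℝ g x e) 0 :=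
    hgd.hasFDerivAt.hasLineDerivAt e
  have hlim := hder.tendsto_slope_zero_right
  simp only [zero_add, zero_smul, add_zero, smul_eq_mul] at hlim
  refine le_of_tendsto ((hlim.sub_const c).abs) ?_
  filter_upwards [Ioo_mem_nhdsGT hδ] with t ht using hdiff t ht

/-- The discounted Liouville equation extends to compactly supported Lipschitz functions that have
a continuous derivative along the flow. -/
theorem liouville_of_lipschitz (Φ : Flow ℝ E) {F : E → E} (hF : Continuous F)
    (hΦ : ∀ x t, HasDerivAt (fun s => Φ s x) (F (Φ t x)) t) {β : ℝ}
    {μ₀ μ μT : Measure E} [IsFiniteMeasure μ₀] [IsFiniteMeasure μ] [IsFiniteMeasure μT]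
    (hL : ∀ v : E → ℝ, ContDiff ℝ 1 v → HasCompactSupport v →
      ∫ x, v x ∂μT = (∫ x, v x ∂μ₀) + ∫ x, (fderiv ℝ v x (F x) - β * v x) ∂μ)
    {L : ℝ≥0} {w D : E → ℝ} (hw : LipschitzWith L w) (hwc : HasCompactSupport w)
    (hDc : Continuous D) (hD : ∀ x, HasDerivAt (fun t => w (Φ t x)) (D x) 0) :
    ∫ x, w x ∂μT = (∫ x, w x ∂μ₀) + ∫ x, (D x - β * w x) ∂μ := by
  let φ : ℕ → ContDiffBump (0 : E) := fun k =>
    ⟨1 / ((k : ℝ) + 2), 1 / ((k : ℝ) + 1), by positivity,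
      one_div_lt_one_div_of_lt (by positivity) (by linarith)⟩
  have hrOut : Tendsto (fun k => (φ k).rOut) atTop (𝓝 0) := tendsto_one_div_add_atTop_nhds_zero_nat
  have hrOut1 : ∀ k, (φ k).rOut ≤ 1 := by
    intro k
    change 1 / ((k : ℝ) + 1) ≤ 1
    rw [div_le_one (by positivity)]
    linarith [(Nat.cast_nonneg k : (0 : ℝ) ≤ k)]
  set W : ℕ → E → ℝ := fun k =>
    (φ k).normed Measure.addHaar ⋆[lsmul ℝ ℝ, Measure.addHaar] w with hW
  have hwcont := hw.continuous
  have hWc1 : ∀ k, ContDiff ℝ 1 (W k) := fun k => (φ k).contDiff_normed_convolution hwcont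
  obtain ⟨R, hR⟩ := hwc.isCompact.isBounded.subset_closedBall 0
  have hw0 : ∀ y, y ∉ closedBall (0 : E) R → w y = 0 := fun y hy =>
    image_eq_zero_of_notMem_tsupport fun h => hy (hR h)
  have hW0 : ∀ k x, x ∉ closedBall (0 : E) (R + 1) → W k x = 0 := by
    intro k x hx
    have h := dist_convolution_le (μ := (Measure.addHaar : Measure E)) (x₀ := x) (z₀ := (0 : ℝ))
      (ε := 0) (R := (φ k).rOut) (f := (φ k).normed Measure.addHaar) (g := w) le_rfl
      (by rw [(φ k).support_normed_eq]) (φ k).nonneg_normed (φ k).integral_normed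
      hwcont.aestronglyMeasurable
      (fun y hy => by
        rw [hw0 y, dist_self]
        intro hy'
        refine hx (mem_closedBall.2 ?_)
        have h1 := mem_ball'.1 hy
        have h2 := mem_closedBall.1 hy'
        have h3 := dist_triangle x y 0
        have h4 := hrOut1 k
        linarith)
    exact dist_le_zero.1 h
  have hWts : ∀ k, tsupport (W k) ⊆ closedBall (0 : E) (R + 1) := fun k =>
    closure_minimal (fun x hx => by_contra fun h => hx (hW0 k x h)) isClosed_closedBall
  have hWcs : ∀ k, HasCompactSupport (W k) := fun k =>
    (isCompact_closedBall _ _).of_isClosed_subset (isClosed_tsupport _) (hWts k)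
  have hWlim : ∀ x, Tendsto (fun k => W k x) atTop (𝓝 (w x)) := fun x =>
    ContDiffBump.convolution_tendsto_right_of_continuous hrOut hwcont x
  obtain ⟨C, hC⟩ := hwcont.bounded_above_of_compact_support hwc
  have hC0 : 0 ≤ C := (norm_nonneg _).trans (hC 0)
  have hWbd : ∀ k x, ‖W k x‖ ≤ C := by
    intro k x
    have h := dist_convolution_le (μ := (Measure.addHaar : Measure E)) (x₀ := x) (z₀ := (0 : ℝ))
      (ε := C) (R := (φ k).rOut) (f := (φ k).normed Measure.addHaar) (g := w) hC0
      (by rw [(φ k).support_normed_eq]) (φ k).nonneg_normed (φ k).integral_normed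
      hwcont.aestronglyMeasurable (fun y _ => by simpa using hC y)
    simpa using h
  have hWint : ∀ (m : Measure E) [IsFiniteMeasure m],
      Tendsto (fun k => ∫ x, W k x ∂m) atTop (𝓝 (∫ x, w x ∂m)) := by
    intro m _
    exact tendsto_integral_of_dominated_convergence (fun _ => C)
      (fun k => (hWc1 k).continuous.aestronglyMeasurable) (integrable_const C)
      (fun k => Eventually.of_forall (hWbd k)) (Eventually.of_forall hWlim)
  obtain ⟨M, hM⟩ := (isCompact_closedBall (0 : E) (R + 1)).exists_bound_of_continuousOn
    hF.continuousOn
  have hdbd : ∀ k x, ‖fderiv ℝ (W k) x (F x)‖ ≤ L * |M| := by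
    intro k x
    by_cases hx : x ∈ closedBall (0 : E) (R + 1)
    -- With `c = 0` the estimate is just the Lipschitz bound on `w`; it supplies the domination,
    -- uniform in `k`.
    · have h := (φ k).abs_fderiv_normed_convolution_sub_le hwcont (x := x) (e := F x) (c := 0)
        (η := L * ‖F x‖) (by positivity) one_pos (fun y _ t ht => by
          have := hw.norm_sub_le (y + t • F x) y
          rw [add_sub_cancel_left, norm_smul, Real.norm_of_nonneg ht.1.le] at this
          rw [mul_zero, sub_zero, ← Real.norm_eq_abs]
          linarith)
      rw [sub_zero] at h
      exact h.trans (by gcongr; exact (hM x hx).trans (le_abs_self M))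
    · have : fderiv ℝ (W k) x = 0 := by
        by_contra hne
        exact hx (hWts k (support_fderiv_subset ℝ hne))
      rw [this]
      simp only [zero_apply, norm_zero]
      positivity
  have hdlim : ∀ x, Tendsto (fun k => fderiv ℝ (W k) x (F x)) atTop (𝓝 (D x)) := by
    intro x
    refine Metric.tendsto_nhds.2 fun ε hε => ?_
    -- Pointwise convergence needs increments of `w` in the fixed direction `F x` from all base
    -- points near `x`, not only along the orbit of `x`.
    obtain ⟨δ, hδ, hδ'⟩ := Φ.exists_abs_sub_sub_le hF hΦ hw hDc hD x (half_pos hε)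
    filter_upwards [hrOut.eventually_lt_const hδ] with k hk
    rw [Real.dist_eq]
    refine ((φ k).abs_fderiv_normed_convolution_sub_le hwcont (half_pos hε).le hδ
      (fun y hy => hδ' y (ball_subset_ball hk.le hy))).trans_lt (half_lt_self hε)
  have hdint : Tendsto (fun k => ∫ x, (fderiv ℝ (W k) x (F x) - β * W k x) ∂μ) atTop
      (𝓝 (∫ x, (D x - β * w x) ∂μ)) := by
    refine tendsto_integral_of_dominated_convergence (fun _ => L * |M| + |β| * C) (fun k => ?_)
      (integrable_const _) (fun k => Eventually.of_forall fun x => ?_)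
      (Eventually.of_forall fun x => (hdlim x).sub ((hWlim x).const_mul β))
    · have h1 := (hWc1 k).continuous_fderiv one_ne_zero
      have h2 := (hWc1 k).continuous
      exact ((h1.clm_apply hF).sub (h2.const_mul β)).aestronglyMeasurable
    · refine (norm_sub_le _ _).trans (add_le_add (hdbd k x) ?_)
      rw [norm_mul, Real.norm_eq_abs]
      gcongr
      exact hWbd k x
  refine tendsto_nhds_unique (hWint μT) ?_
  simp_rw [fun k => hL (W k) (hWc1 k) (hWcs k)]
  exact (hWint μ₀).add hdint

end Mollification

/-! ### Discounted resolvent of the flow and the integrated Liouville equation. -/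

section Resolvent

/-- Finite measures on a proper metric space are determined by the integrals of compactly supported
Lipschitz functions. -/
theorem MeasureTheory.Measure.ext_of_integral_lipschitz {X : Type*} [MetricSpace X] [ProperSpace X]
    [MeasurableSpace X] [BorelSpace X] {m m' : Measure X} [IsFiniteMeasure m] [IsFiniteMeasure m']
    (h : ∀ (L : ℝ≥0) (v : X → ℝ), LipschitzWith L v → HasCompactSupport v →
      ∫ x, v x ∂m = ∫ x, v x ∂m') : m = m' := by
  apply Measure.OuterRegular.ext_isOpen
  apply Measure.InnerRegularWRT.eq_of_innerRegularWRT_of_forall_eq Measure.Regular.innerRegular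
    Measure.Regular.innerRegular
  intro K hK
  -- Thickened indicators of a compact set are Lipschitz with compact support, so they are
  -- admissible and recover its measure in the limit.
  have hpos : ∀ k : ℕ, 0 < 1 / ((k : ℝ) + 1) := fun k => by positivity
  have hlim := tendsto_integral_thickenedIndicator_of_isClosed m hK.isClosed hpos
    tendsto_one_div_add_atTop_nhds_zero_nat
  have hlim' := tendsto_integral_thickenedIndicator_of_isClosed m' hK.isClosed hpos
    tendsto_one_div_add_atTop_nhds_zero_nat
  have heq : ∀ k, ∫ x, (thickenedIndicator (hpos k) K x : ℝ) ∂m =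
      ∫ x, (thickenedIndicator (hpos k) K x : ℝ) ∂m' := by
    intro k
    refine h _ _ (NNReal.isometry_coe.lipschitz.comp (lipschitzWith_thickenedIndicator (hpos k) K)) ?_
    refine HasCompactSupport.intro (hK.cthickening (r := 1 / ((k : ℝ) + 1))) fun x hx => ?_
    have : thickenedIndicator (hpos k) K x = 0 :=
      thickenedIndicator_zero (hpos k) K fun hx' => hx (Metric.thickening_subset_cthickening _ _ hx')
    exact congrArg NNReal.toReal this
  simp_rw [heq] at hlim
  have := tendsto_nhds_unique hlim hlim'
  rwa [Measure.real, Measure.real, ENNReal.toReal_eq_toReal_iff' (by finiteness) (by finiteness)]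
    at this

/-- The measure `e^{-βt} dt` on `[0,∞)`. -/
noncomputable def discountMeasure (β : ℝ) : Measure ℝ :=
  (volume.restrict (Ici 0)).withDensity fun t => ENNReal.ofReal (Real.exp (-β * t))

lemma measurable_discount (β : ℝ) : Measurable fun t : ℝ => ENNReal.ofReal (Real.exp (-β * t)) := by
  fun_prop

lemma integrableOn_discount {β : ℝ} (hβ : 0 < β) (a : ℝ) :
    IntegrableOn (fun t : ℝ => Real.exp (-β * t)) (Ici a) :=
  (integrableOn_Ici_iff_integrableOn_Ioi (by simp)).2 (exp_neg_integrableOn_Ioi a hβ)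

lemma isFiniteMeasure_discountMeasure {β : ℝ} (hβ : 0 < β) :
    IsFiniteMeasure (discountMeasure β) :=
  isFiniteMeasure_withDensity_ofReal (integrableOn_discount hβ 0).2

lemma integral_discountMeasure (β : ℝ) (g : ℝ → ℝ) :
    ∫ t, g t ∂(discountMeasure β) = ∫ t in Ici 0, Real.exp (-β * t) * g t := by
  rw [discountMeasure, integral_withDensity_eq_integral_toReal_smul (measurable_discount β)
    (Eventually.of_forall fun _ => ENNReal.ofReal_lt_top)]
  simp [ENNReal.toReal_ofReal (Real.exp_pos _).le]

lemma integrableOn_discount_mul {β : ℝ} (hβ : 0 < β) {g : ℝ → ℝ} (hg : Continuous g) {C : ℝ}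
    (hC : ∀ t, |g t| ≤ C) (a : ℝ) : IntegrableOn (fun t => Real.exp (-β * t) * g t) (Ici a) :=
  (integrableOn_discount hβ a).mul_bdd (c := C) hg.aestronglyMeasurable (Eventually.of_forall hC)

section Flow

variable {X : Type*} [TopologicalSpace X]

lemma Flow.continuous_swap (Φ : Flow ℝ X) : Continuous fun p : X × ℝ => Φ p.2 p.1 := by fun_prop

variable [MeasurableSpace X]

/-- The discounted occupation measure of the flow started from `m`. -/
noncomputable def Flow.resolvent (Φ : Flow ℝ X) (β : ℝ) (m : Measure X) : Measure X :=
  (m.prod (discountMeasure β)).map fun p => Φ p.2 p.1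

lemma Flow.isFiniteMeasure_resolvent (Φ : Flow ℝ X) {β : ℝ} (hβ : 0 < β) (m : Measure X)
    [IsFiniteMeasure m] : IsFiniteMeasure (Φ.resolvent β m) := by
  have := isFiniteMeasure_discountMeasure hβ
  unfold Flow.resolvent
  infer_instance

variable [SecondCountableTopology X] [BorelSpace X]

lemma Flow.integral_resolvent (Φ : Flow ℝ X) {β : ℝ} (hβ : 0 < β) (m : Measure X)
    [IsFiniteMeasure m] {v : X → ℝ} (hv : Continuous v) {C : ℝ} (hC : ∀ x, |v x| ≤ C) :
    ∫ x, v x ∂(Φ.resolvent β m) = ∫ x, (∫ t in Ici 0, Real.exp (-β * t) * v (Φ t x)) ∂m := by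
  have := isFiniteMeasure_discountMeasure hβ
  have hmeas : Measurable fun p : X × ℝ => Φ p.2 p.1 := Φ.continuous_swap.measurable
  rw [Flow.resolvent, integral_map hmeas.aemeasurable hv.aestronglyMeasurable, integral_prod]
  · simp_rw [integral_discountMeasure]
  · exact Integrable.of_bound ((hv.comp Φ.continuous_swap).aestronglyMeasurable) C
      (Eventually.of_forall fun p => hC _)

/-- If `μ + resolvent μT = resolvent μ₀` then bounded continuous excessive functions have a smaller
integral with respect to `μT` than with respect to `μ₀`. -/
theorem Flow.integral_le_of_excessive (Φ : Flow ℝ X) {β : ℝ} (hβ : 0 < β) {μ₀ μ μT : Measure X}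
    [IsFiniteMeasure μ₀] [IsFiniteMeasure μ] [IsFiniteMeasure μT]
    (hres : μ + Φ.resolvent β μT = Φ.resolvent β μ₀) {w : X → ℝ} (hw : Continuous w) {C : ℝ}
    (hC : ∀ x, |w x| ≤ C) (hexc : ∀ t, 0 ≤ t → ∀ x, Real.exp (-β * t) * w (Φ t x) ≤ w x) :
    ∫ x, w x ∂μT ≤ ∫ x, w x ∂μ₀ := by
  have hfT := Φ.isFiniteMeasure_resolvent hβ μT
  have hqc : ∀ x, Continuous fun t => w (Φ t x) := fun x => by fun_prop
  have hanti : ∀ x, Antitone fun t => Real.exp (-β * t) * w (Φ t x) := by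
    intro x s t hst
    have h := hexc (t - s) (sub_nonneg.2 hst) (Φ s x)
    rw [← Φ.map_add, sub_add_cancel] at h
    calc Real.exp (-β * t) * w (Φ t x)
        = Real.exp (-β * s) * (Real.exp (-β * (t - s)) * w (Φ t x)) := by
          rw [← mul_assoc, ← Real.exp_add]; ring_nf
      _ ≤ _ := mul_le_mul_of_nonneg_left h (Real.exp_pos _).le
  -- Compare the resolvents on `h = w - e^{-βε} w ∘ Φ_ε`, which is nonnegative by excessivity. The
  -- resolvent integral of `h` telescopes to `∫₀^ε e^{-βt} w(Φ_t x) dt`, squeezed by monotonicity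
  -- between `ε e^{-βε} w(Φ_ε x)` and `ε w(x)`.
  have key : ∀ ε > 0, ∫ x, Real.exp (-β * ε) * w (Φ ε x) ∂μT ≤ ∫ x, w x ∂μ₀ := by
    intro ε hε
    set h : X → ℝ := fun x => w x - Real.exp (-β * ε) * w (Φ ε x) with hh
    have hhc : Continuous h := by fun_prop
    have hh0 : ∀ x, 0 ≤ h x := fun x => sub_nonneg.2 (hexc ε hε.le x)
    have hhC : ∀ x, |h x| ≤ C + C := by
      intro x
      refine (abs_sub _ _).trans (add_le_add (hC x) ?_)
      rw [abs_mul, abs_of_pos (Real.exp_pos _)]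
      calc _ ≤ 1 * |w (Φ ε x)| := by
            gcongr
            exact Real.exp_le_one_iff.2 (by nlinarith)
        _ ≤ C := by simpa using hC _
    have hinner : ∀ x, ∫ t in Ici 0, Real.exp (-β * t) * h (Φ t x) =
        ∫ t in (0 : ℝ)..ε, Real.exp (-β * t) * w (Φ t x) := by
      intro x
      have hi := fun a => integrableOn_discount_mul hβ (hqc x) (fun t => hC (Φ t x)) a
      have hshift : ∫ t in Ioi 0, Real.exp (-β * (t + ε)) * w (Φ (t + ε) x) =
          ∫ t in Ioi ε, Real.exp (-β * t) * w (Φ t x) := by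
        have := (measurePreserving_add_right volume ε).setIntegral_preimage_emb
          (measurableEmbedding_addRight ε) (fun t => Real.exp (-β * t) * w (Φ t x)) (Ioi ε)
        simpa using this
      have hishift : IntegrableOn (fun t => Real.exp (-β * (t + ε)) * w (Φ (t + ε) x)) (Ioi 0) := by
        have := (measurePreserving_add_right volume ε).integrableOn_comp_preimage
          (measurableEmbedding_addRight ε) (f := fun t => Real.exp (-β * t) * w (Φ t x))
          (s := Ioi ε)
        simp only [preimage_add_const_Ioi, sub_self] at this
        exact this.2 ((hi ε).mono_set Ioi_subset_Ici_self)
      have hi0 := (hi 0).mono_set Ioi_subset_Ici_self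
      rw [integral_Ici_eq_integral_Ioi, ← intervalIntegral.integral_Ioi_sub_Ioi hi0 hε.le,
        ← hshift, ← integral_sub hi0 hishift]
      refine integral_congr_ae (Eventually.of_forall fun t => ?_)
      simp only [hh, ← Φ.map_add]
      rw [mul_sub, ← mul_assoc, ← Real.exp_add, add_comm ε t]
      ring_nf
    have hA : ∫ x, (∫ t in (0 : ℝ)..ε, Real.exp (-β * t) * w (Φ t x)) ∂μT ≤
        ∫ x, (∫ t in (0 : ℝ)..ε, Real.exp (-β * t) * w (Φ t x)) ∂μ₀ := by
      simp_rw [← hinner]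
      rw [← Φ.integral_resolvent hβ μT hhc hhC, ← Φ.integral_resolvent hβ μ₀ hhc hhC, ← hres,
        integral_add_measure (Integrable.of_bound hhc.aestronglyMeasurable _
          (Eventually.of_forall hhC)) (Integrable.of_bound hhc.aestronglyMeasurable _
          (Eventually.of_forall hhC))]
      exact le_add_of_nonneg_left (integral_nonneg hh0)
    have hlow : ∀ x, ε * (Real.exp (-β * ε) * w (Φ ε x)) ≤
        ∫ t in (0 : ℝ)..ε, Real.exp (-β * t) * w (Φ t x) := by
      intro x
      have := intervalIntegral.integral_mono_on (μ := volume) hε.le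
        (f := fun _ => Real.exp (-β * ε) * w (Φ ε x))
        (g := fun t => Real.exp (-β * t) * w (Φ t x)) intervalIntegrable_const
        (Continuous.intervalIntegrable (by fun_prop) _ _) (fun t ht => hanti x ht.2)
      rwa [intervalIntegral.integral_const, sub_zero, smul_eq_mul] at this
    have hup : ∀ x, ∫ t in (0 : ℝ)..ε, Real.exp (-β * t) * w (Φ t x) ≤ ε * w x := by
      intro x
      have := intervalIntegral.integral_mono_on (μ := volume) hε.le
        (g := fun _ => w x)
        (f := fun t => Real.exp (-β * t) * w (Φ t x))
        (Continuous.intervalIntegrable (by fun_prop) _ _) intervalIntegrable_const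
        (fun t ht => hexc t ht.1 x)
      simpa using this
    have hmeasA : Continuous fun x => ∫ t in (0 : ℝ)..ε, Real.exp (-β * t) * w (Φ t x) :=
      intervalIntegral.continuous_parametric_intervalIntegral_of_continuous' (by fun_prop) 0 ε
    have hbdA : ∀ x, |∫ t in (0 : ℝ)..ε, Real.exp (-β * t) * w (Φ t x)| ≤ ε * C := by
      intro x
      have := intervalIntegral.norm_integral_le_of_norm_le_const (a := 0) (b := ε) (C := C)
        (f := fun t => Real.exp (-β * t) * w (Φ t x)) (fun t ht => by
          rw [uIoc_of_le hε.le] at ht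
          rw [norm_mul, Real.norm_of_nonneg (Real.exp_pos _).le]
          calc _ ≤ 1 * |w (Φ t x)| := by
                gcongr
                · exact Real.exp_le_one_iff.2 (by nlinarith [ht.1])
                · exact le_rfl
            _ ≤ C := by simpa using hC _)
      rw [sub_zero, abs_of_pos hε, mul_comm] at this
      exact this
    have hintA : ∀ (m : Measure X) [IsFiniteMeasure m],
        Integrable (fun x => ∫ t in (0 : ℝ)..ε, Real.exp (-β * t) * w (Φ t x)) m := fun m _ =>
      Integrable.of_bound hmeasA.aestronglyMeasurable _ (Eventually.of_forall hbdA)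
    have hintw : ∀ (m : Measure X) [IsFiniteMeasure m], Integrable w m := fun m _ =>
      Integrable.of_bound hw.aestronglyMeasurable _ (Eventually.of_forall hC)
    have hintwε : Integrable (fun x => Real.exp (-β * ε) * w (Φ ε x)) μT :=
      (Integrable.of_bound (by exact Continuous.aestronglyMeasurable (by fun_prop)) C
        (Eventually.of_forall fun x => hC (Φ ε x))).const_mul _
    have h1 := integral_mono (hintwε.const_mul ε) (hintA μT) hlow
    have h2 := integral_mono (hintA μ₀) ((hintw μ₀).const_mul ε) hup
    rw [integral_const_mul] at h1 h2
    exact le_of_mul_le_mul_left (h1.trans (hA.trans h2)) hε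
  have hlim : Tendsto (fun ε : ℝ => ∫ x, Real.exp (-β * ε) * w (Φ ε x) ∂μT) (𝓝[>] 0)
      (𝓝 (∫ x, w x ∂μT)) := by
    refine tendsto_integral_filter_of_dominated_convergence (fun _ => C)
      (Eventually.of_forall fun ε => by exact Continuous.aestronglyMeasurable (by fun_prop)) ?_
      (integrable_const C) (Eventually.of_forall fun x => ?_)
    · filter_upwards [self_mem_nhdsWithin] with ε hε
      refine Eventually.of_forall fun x => ?_
      rw [norm_mul, Real.norm_of_nonneg (Real.exp_pos _).le]
      calc _ ≤ 1 * |w (Φ ε x)| := by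
            gcongr
            · exact Real.exp_le_one_iff.2 (by nlinarith [mem_Ioi.1 hε])
            · exact le_rfl
        _ ≤ C := by simpa using hC _
    · have hc : Continuous fun ε : ℝ => Real.exp (-β * ε) * w (Φ ε x) := by fun_prop
      have := (hc.tendsto 0).mono_left (nhdsWithin_le_nhds (s := Ioi 0))
      simpa using this
  refine le_of_tendsto hlim ?_
  filter_upwards [self_mem_nhdsWithin] with ε hε using key ε hε

end Flow

section Liouville

variable {E : Type*} [NormedAddCommGroup E] [NormedSpace ℝ E] [FiniteDimensional ℝ E]
  [MeasurableSpace E] [BorelSpace E]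

/-- The discounted Liouville equation in integrated form. -/
theorem add_resolvent_eq_resolvent_of_liouville (Φ : Flow ℝ E) {F : E → E} (hF : Continuous F)
    (hΦ : ∀ x t, HasDerivAt (fun s => Φ s x) (F (Φ t x)) t) {K : ℝ≥0}
    (hΦL : ∀ t x y, dist (Φ t x) (Φ t y) ≤ dist x y * Real.exp (K * |t|)) {β : ℝ} (hβ : 0 < β)
    {μ₀ μ μT : Measure E} [IsFiniteMeasure μ₀] [IsFiniteMeasure μ] [IsFiniteMeasure μT]
    (hL : ∀ v : E → ℝ, ContDiff ℝ 1 v → HasCompactSupport v →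
      ∫ x, v x ∂μT = (∫ x, v x ∂μ₀) + ∫ x, (fderiv ℝ v x (F x) - β * v x) ∂μ) :
    μ + Φ.resolvent β μT = Φ.resolvent β μ₀ := by
  have hfT := Φ.isFiniteMeasure_resolvent hβ μT
  have hf0 := Φ.isFiniteMeasure_resolvent hβ μ₀
  refine Measure.ext_of_integral_lipschitz fun L v hv hvc => ?_
  have hvcont := hv.continuous
  obtain ⟨C, hC⟩ := hvcont.bounded_above_of_compact_support hvc
  have hintv : ∀ (m : Measure E) [IsFiniteMeasure m], Integrable v m := fun m _ =>
    Integrable.of_bound hvcont.aestronglyMeasurable C (Eventually.of_forall hC)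
  rw [integral_add_measure (hintv _) (hintv _), Φ.integral_resolvent hβ μT hvcont hC,
    Φ.integral_resolvent hβ μ₀ hvcont hC]
  -- Truncating at `T` keeps the test function Lipschitz and compactly supported: the Lipschitz
  -- bound `T L e^{KT}` is useless for `T = ∞`.
  set W : ℕ → E → ℝ := fun T x => ∫ t in (0 : ℝ)..T, Real.exp (-β * t) * v (Φ t x) with hW
  have hqc : ∀ x, Continuous fun t => Real.exp (-β * t) * v (Φ t x) := fun x => by fun_prop
  have hexp : ∀ t : ℝ, 0 ≤ t → Real.exp (-β * t) ≤ 1 := fun t ht =>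
    Real.exp_le_one_iff.2 (by nlinarith)
  have hWlip : ∀ T : ℕ, LipschitzWith (T * (L * Real.toNNReal (Real.exp (K * T)))) (W T) := by
    intro T
    refine LipschitzWith.of_dist_le_mul fun x y => ?_
    rw [dist_eq_norm, hW]
    simp only
    rw [← intervalIntegral.integral_sub ((hqc x).intervalIntegrable _ _)
      ((hqc y).intervalIntegrable _ _)]
    refine (intervalIntegral.norm_integral_le_of_norm_le_const
      (C := L * (dist x y * Real.exp (K * T))) fun t ht => ?_).trans_eq ?_
    · rw [uIoc_of_le (Nat.cast_nonneg T)] at ht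
      rw [← mul_sub, norm_mul, Real.norm_of_nonneg (Real.exp_pos _).le, ← dist_eq_norm]
      calc _ ≤ 1 * (L * (dist x y * Real.exp (K * |t|))) := by
            gcongr
            · exact hexp t ht.1.le
            · exact (hv.dist_le_mul _ _).trans (by gcongr; exact hΦL t x y)
        _ ≤ _ := by
            rw [one_mul, abs_of_pos ht.1]
            gcongr
            exact ht.2
    · simp only [sub_zero, Nat.abs_cast, NNReal.coe_mul, NNReal.coe_natCast,
        Real.coe_toNNReal _ (Real.exp_pos _).le]
      ring
  have hWcs : ∀ T, HasCompactSupport (W T) := by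
    intro T
    refine HasCompactSupport.intro (K := (fun p : ℝ × E => Φ (-p.1) p.2) ''
      (Icc (0 : ℝ) T ×ˢ tsupport v))
      ((isCompact_Icc.prod hvc.isCompact).image (by fun_prop)) fun x hx => ?_
    refine (intervalIntegral.integral_congr (g := fun _ => 0) fun t ht => ?_).trans (by simp)
    rw [uIcc_of_le (Nat.cast_nonneg T)] at ht
    have : v (Φ t x) = 0 := by
      refine image_eq_zero_of_notMem_tsupport fun h => hx ⟨(t, Φ t x), ⟨ht, h⟩, ?_⟩
      simp [← Φ.map_add]
    simp [this]
  -- The term `β W` cancels the discount term of the Liouville equation, leaving the boundary terms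
  -- `e^{-βT} v(Φ_T x) - v(x)`.
  have hWD : ∀ (T : ℕ) x, HasDerivAt (fun h => W T (Φ h x))
      (β * W T x + (Real.exp (-β * T) * v (Φ T x) - v x)) 0 := by
    intro T x
    set G : ℝ → ℝ := fun s => ∫ r in (0 : ℝ)..s, Real.exp (-β * r) * v (Φ r x) with hG
    have hGd : ∀ s, HasDerivAt G (Real.exp (-β * s) * v (Φ s x)) s := fun s =>
      intervalIntegral.integral_hasDerivAt_right ((hqc x).intervalIntegrable _ _)
        (hqc x).aestronglyMeasurable.stronglyMeasurableAtFilter (hqc x).continuousAt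
    have heq : (fun h => W T (Φ h x)) = fun h => Real.exp (β * h) * (G (T + h) - G h) := by
      funext h
      rw [hG]
      simp only
      rw [intervalIntegral.integral_interval_sub_left ((hqc x).intervalIntegrable _ _)
        ((hqc x).intervalIntegrable _ _), ← intervalIntegral.integral_const_mul]
      have := intervalIntegral.integral_comp_add_right (a := 0) (b := (T : ℝ))
        (fun r => Real.exp (β * h) * (Real.exp (-β * r) * v (Φ r x))) h
      rw [zero_add] at this
      rw [← this]
      refine intervalIntegral.integral_congr fun t _ => ?_
      simp only [← Φ.map_add]
      rw [← mul_assoc, ← Real.exp_add]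
      ring_nf
    rw [heq]
    have h1 : HasDerivAt (fun h : ℝ => Real.exp (β * h)) (Real.exp (β * 0) * β) 0 := by
      simpa using ((hasDerivAt_id (0 : ℝ)).const_mul β).exp
    have h2 : HasDerivAt (fun h : ℝ => G (T + h) - G h)
        (Real.exp (-β * (T + 0)) * v (Φ (T + 0) x) - Real.exp (-β * 0) * v (Φ 0 x)) 0 :=
      ((hGd (T + 0)).comp_const_add (T : ℝ) 0).sub (hGd 0)
    refine (h1.mul h2).congr_deriv ?_
    simp [hG, hW, mul_comm]
  have hWliou : ∀ T : ℕ, ∫ x, W T x ∂μT = (∫ x, W T x ∂μ₀) +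
      ∫ x, (Real.exp (-β * T) * v (Φ T x) - v x) ∂μ := by
    intro T
    have hWc := (hWlip T).continuous
    rw [liouville_of_lipschitz Φ hF hΦ hL (hWlip T) (hWcs T) (by fun_prop) (hWD T)]
    simp
  set B : ℝ := ∫ t in Ici (0 : ℝ), Real.exp (-β * t) * C
  have hWbd : ∀ (T : ℕ) x, ‖W T x‖ ≤ B := by
    intro T x
    have hC0 : 0 ≤ C := (norm_nonneg _).trans (hC 0)
    have hiC := (integrableOn_discount hβ 0).mul_const C
    refine (intervalIntegral.norm_integral_le_of_norm_le (g := fun t => Real.exp (-β * t) * C)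
      (Nat.cast_nonneg T) (Eventually.of_forall fun t _ => ?_)
      (Continuous.intervalIntegrable (by fun_prop) _ _)).trans ?_
    · rw [norm_mul, Real.norm_of_nonneg (Real.exp_pos _).le]
      gcongr
      exact hC _
    · rw [intervalIntegral.integral_of_le (Nat.cast_nonneg T)]
      refine setIntegral_mono_set hiC (Eventually.of_forall fun t => ?_)
        (Eventually.of_forall (Ioc_subset_Ioi_self.trans Ioi_subset_Ici_self))
      simp only [Pi.zero_apply]
      positivity
  have hWlim : ∀ (m : Measure E) [IsFiniteMeasure m], Tendsto (fun T => ∫ x, W T x ∂m) atTop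
      (𝓝 (∫ x, (∫ t in Ici 0, Real.exp (-β * t) * v (Φ t x)) ∂m)) := by
    intro m _
    refine tendsto_integral_of_dominated_convergence (fun _ => B)
      (fun T => (hWlip T).continuous.aestronglyMeasurable) (integrable_const B)
      (fun T => Eventually.of_forall (hWbd T)) (Eventually.of_forall fun x => ?_)
    rw [integral_Ici_eq_integral_Ioi]
    exact intervalIntegral_tendsto_integral_Ioi 0
      ((integrableOn_discount_mul hβ (by fun_prop) (fun t => hC (Φ t x)) 0).mono_set
        Ioi_subset_Ici_self) tendsto_natCast_atTop_atTop
  have hrem : Tendsto (fun T : ℕ => ∫ x, (Real.exp (-β * T) * v (Φ T x) - v x) ∂μ) atTop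
      (𝓝 (∫ x, (0 - v x) ∂μ)) := by
    refine tendsto_integral_of_dominated_convergence (fun _ => C + C)
      (fun T => by exact Continuous.aestronglyMeasurable (by fun_prop)) (integrable_const _)
      (fun T => Eventually.of_forall fun x => ?_) (Eventually.of_forall fun x => ?_)
    · refine (norm_sub_le _ _).trans (add_le_add ?_ (hC x))
      rw [norm_mul, Real.norm_of_nonneg (Real.exp_pos _).le]
      calc _ ≤ 1 * ‖v (Φ T x)‖ := by gcongr; exact hexp _ (Nat.cast_nonneg T)
        _ ≤ C := by simpa using hC _
    · refine Tendsto.sub_const ?_ _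
      have hlim : Tendsto (fun T : ℕ => Real.exp (-β * T) * C) atTop (𝓝 0) := by
        have h1 : Tendsto (fun T : ℕ => -β * (T : ℝ)) atTop atBot :=
          tendsto_natCast_atTop_atTop.const_mul_atTop_of_neg (by linarith)
        simpa using (Real.tendsto_exp_atBot.comp h1).mul_const C
      refine squeeze_zero_norm (fun T => ?_) hlim
      rw [norm_mul, Real.norm_of_nonneg (Real.exp_pos _).le]
      gcongr
      exact hC _
  have hfinal := tendsto_nhds_unique (hWlim μT) (by
    simp_rw [hWliou]
    exact (hWlim μ₀).add hrem)
  simp only [zero_sub, integral_neg] at hfinal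
  linarith

end Liouville

end Resolvent

/-! ### Representing dominated functionals by measures with a given marginal. -/

section Duality

open scoped CompactlySupported

section Sup

variable {X Y : Type*} [TopologicalSpace X] [TopologicalSpace Y]

lemma BoundedContinuousFunction.bddAbove_range_section (ψ : X × Y →ᵇ ℝ) (x : X) :
    BddAbove (range fun y => ψ (x, y)) :=
  ⟨‖ψ‖, by rintro _ ⟨y, rfl⟩; exact (le_abs_self _).trans (ψ.norm_coe_le_norm _)⟩

lemma BoundedContinuousFunction.continuous_iSup_section [CompactSpace Y] (ψ : X × Y →ᵇ ℝ) :
    Continuous fun x => ⨆ y, ψ (x, y) := by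
  have := isCompact_univ.continuous_sSup (f := fun (x : X) (y : Y) => ψ (x, y)) (K := univ)
    ψ.continuous
  simpa [image_univ, sSup_range] using this

lemma BoundedContinuousFunction.abs_iSup_section_le [Nonempty Y] (ψ : X × Y →ᵇ ℝ) (x : X) :
    |⨆ y, ψ (x, y)| ≤ ‖ψ‖ := by
  obtain ⟨y₀⟩ := ‹Nonempty Y›
  refine abs_le.2 ⟨?_, ciSup_le fun y => (le_abs_self _).trans (ψ.norm_coe_le_norm _)⟩
  exact (neg_le_of_abs_le (ψ.norm_coe_le_norm (x, y₀))).trans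
    (le_ciSup (ψ.bddAbove_range_section x) y₀)

lemma BoundedContinuousFunction.integrable_iSup_section [CompactSpace Y] [Nonempty Y]
    [MeasurableSpace X] [OpensMeasurableSpace X] (m : Measure X) [IsFiniteMeasure m]
    (ψ : X × Y →ᵇ ℝ) : Integrable (fun x => ⨆ y, ψ (x, y)) m :=
  Integrable.of_bound ψ.continuous_iSup_section.aestronglyMeasurable ‖ψ‖
    (Eventually.of_forall ψ.abs_iSup_section_le)

end Sup

variable {X Y : Type*} [MetricSpace X] [ProperSpace X] [Nonempty X] [MeasurableSpace X]
  [BorelSpace X] [TopologicalSpace Y] [CompactSpace Y] [T2Space Y] [SecondCountableTopology Y]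
  [Nonempty Y] [MeasurableSpace Y] [BorelSpace Y]

/-- A linear functional on bounded continuous functions on `X × Y`, `Y` compact, that is dominated
by `ψ ↦ ∫ sup_y ψ(x,y) dμ₀(x)` is the integral against a measure with first marginal `μ₀`. -/
theorem exists_measure_of_forall_le_integral_iSup (μ₀ : Measure X) [IsFiniteMeasure μ₀]
    (L : (X × Y →ᵇ ℝ) →ₗ[ℝ] ℝ) (hL : ∀ ψ, L ψ ≤ ∫ x, (⨆ y, ψ (x, y)) ∂μ₀) :
    ∃ σ : Measure (X × Y), IsFiniteMeasure σ ∧ σ.fst = μ₀ ∧ ∀ ψ, ∫ p, ψ p ∂σ = L ψ := by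
  have hLle : ∀ (ψ : X × Y →ᵇ ℝ) (g : X → ℝ), Integrable g μ₀ → (∀ x y, ψ (x, y) ≤ g x) →
      L ψ ≤ ∫ x, g x ∂μ₀ := fun ψ g hg h =>
    (hL ψ).trans (integral_mono (ψ.integrable_iSup_section μ₀) hg fun x => ciSup_le (h x))
  have hLnonneg : ∀ ψ : X × Y →ᵇ ℝ, (∀ p, 0 ≤ ψ p) → 0 ≤ L ψ := by
    intro ψ h
    have := hLle (-ψ) (fun _ => 0) (integrable_zero _ _ _) fun x y => by simpa using h (x, y)
    simpa using this
  have hLabs : ∀ (ψ : X × Y →ᵇ ℝ) (g : X → ℝ), Integrable g μ₀ → (∀ x y, |ψ (x, y)| ≤ g x) →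
      |L ψ| ≤ ∫ x, g x ∂μ₀ := by
    intro ψ g hg h
    refine abs_le'.2 ⟨hLle ψ g hg fun x y => (le_abs_self _).trans (h x y), ?_⟩
    rw [← map_neg]
    exact hLle (-ψ) g hg fun x y => (neg_le_abs _).trans (h x y)
  -- `X` need not be compact, so Riesz only sees compactly supported functions; the cutoffs `χ k` in
  -- the `X` variable recover the bounded ones.
  let Λ : C_c(X × Y, ℝ) →ₚ[ℝ] ℝ := PositiveLinearMap.mk₀
    { toFun := fun f => L f.toBoundedContinuousFunction
      map_add' := fun f g => by
        rw [← map_add]; rfl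
      map_smul' := fun c f => by
        rw [RingHom.id_apply, ← map_smul]; rfl }
    (fun f hf => hLnonneg _ hf)
  set σ := RealRMK.rieszMeasure Λ
  have hσint : ∀ f : C_c(X × Y, ℝ), ∫ p, f p ∂σ = L f.toBoundedContinuousFunction := fun f =>
    RealRMK.integral_rieszMeasure Λ f
  obtain ⟨o⟩ := ‹Nonempty X›
  let χ : ℕ → X → ℝ := fun k x => thickenedIndicator one_pos (Metric.closedBall o k) x
  have hχc : ∀ k, Continuous (χ k) := fun k =>
    NNReal.continuous_coe.comp (thickenedIndicator one_pos _).continuous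
  have hχ0 : ∀ k x, 0 ≤ χ k x := fun k x => NNReal.coe_nonneg _
  have hχ1 : ∀ k x, χ k x ≤ 1 := fun k x => by
    exact_mod_cast thickenedIndicator_le_one one_pos _ x
  have hχone : ∀ k : ℕ, ∀ x ∈ Metric.closedBall o (k : ℝ), χ k x = 1 := fun k x hx => by
    exact congrArg NNReal.toReal (thickenedIndicator_one one_pos _ hx)
  have hχzero : ∀ k : ℕ, ∀ x ∉ Metric.cthickening 1 (Metric.closedBall o (k : ℝ)), χ k x = 0 :=
    fun k x hx => by
      exact congrArg NNReal.toReal (thickenedIndicator_zero one_pos _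
        fun h => hx (Metric.thickening_subset_cthickening _ _ h))
  have hχlim : ∀ x, ∀ᶠ k in atTop, χ k x = 1 := by
    intro x
    obtain ⟨N, hN⟩ := exists_nat_ge (dist x o)
    filter_upwards [eventually_ge_atTop N] with k hk
    exact hχone k x (Metric.mem_closedBall.2 (hN.trans (by exact_mod_cast hk)))
  have hχint : ∀ k, Integrable (χ k) μ₀ := fun k =>
    Integrable.of_bound (hχc k).aestronglyMeasurable 1
      (Eventually.of_forall fun x => by rw [Real.norm_of_nonneg (hχ0 k x)]; exact hχ1 k x)
  let cut : ℕ → (X × Y →ᵇ ℝ) → C_c(X × Y, ℝ) := fun k ψ =>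
    { toFun := fun p => χ k p.1 * ψ p
      continuous_toFun := ((hχc k).comp continuous_fst).mul ψ.continuous
      hasCompactSupport' := by
        refine HasCompactSupport.intro
          (((isCompact_closedBall o (k : ℝ)).cthickening (r := 1)).prod
            (isCompact_univ : IsCompact (univ : Set Y))) fun p hp => ?_
        have : p.1 ∉ Metric.cthickening 1 (Metric.closedBall o (k : ℝ)) := fun h =>
          hp ⟨h, mem_univ _⟩
        simp [hχzero k p.1 this] }
  have hcut : ∀ k ψ p, cut k ψ p = χ k p.1 * ψ p := fun _ _ _ => rfl
  have hσK : ∀ k : ℕ, σ (Metric.closedBall o (k : ℝ) ×ˢ univ) ≤ μ₀ univ := by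
    intro k
    refine (RealRMK.rieszMeasure_le_of_eq_one Λ (f := cut k 1) (fun p => ?_)
      ((isCompact_closedBall o (k : ℝ)).prod isCompact_univ) (fun p hp => ?_)).trans ?_
    · rw [hcut]; simpa using hχ0 k p.1
    · rw [hcut]; simpa using hχone k p.1 hp.1
    · have h1 : Λ (cut k 1) ≤ ∫ _, (1 : ℝ) ∂μ₀ := hLle _ _ (integrable_const 1) fun x y => by
        change χ k x * 1 ≤ 1
        simpa using hχ1 k x
      refine (ENNReal.ofReal_le_ofReal h1).trans_eq ?_
      simp
  have hfin : IsFiniteMeasure σ := by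
    refine ⟨lt_of_le_of_lt ?_ (measure_lt_top μ₀ univ)⟩
    have hmono : Monotone fun k : ℕ => Metric.closedBall o (k : ℝ) ×ˢ (univ : Set Y) := by
      intro a b hab
      exact prod_mono (Metric.closedBall_subset_closedBall (by exact_mod_cast hab)) subset_rfl
    have hU : (univ : Set (X × Y)) = ⋃ k : ℕ, Metric.closedBall o (k : ℝ) ×ˢ (univ : Set Y) := by
      refine (eq_univ_of_forall fun p => ?_).symm
      obtain ⟨N, hN⟩ := exists_nat_ge (dist p.1 o)
      exact mem_iUnion.2 ⟨N, hN, mem_univ _⟩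
    rw [hU, hmono.measure_iUnion]
    exact iSup_le hσK
  have hall : ∀ ψ, ∫ p, ψ p ∂σ = L ψ := by
    intro ψ
    have h1 : Tendsto (fun k => ∫ p, cut k ψ p ∂σ) atTop (𝓝 (∫ p, ψ p ∂σ)) := by
      refine tendsto_integral_of_dominated_convergence (fun _ => ‖ψ‖)
        (fun k => (cut k ψ).continuous.aestronglyMeasurable) (integrable_const _)
        (fun k => Eventually.of_forall fun p => ?_) (Eventually.of_forall fun p => ?_)
      · rw [hcut, norm_mul, Real.norm_of_nonneg (hχ0 k p.1)]
        exact (mul_le_of_le_one_left (norm_nonneg _) (hχ1 k p.1)).trans (ψ.norm_coe_le_norm p)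
      · refine tendsto_const_nhds.congr' ?_
        filter_upwards [hχlim p.1] with k hk
        rw [hcut, hk, one_mul]
    -- No part of `L` lives at infinity: the domination bounds `|L ψ - L (χ_k ψ)|` by `∫ (1 - χ_k)
    -- ‖ψ‖ dμ₀`, which tends to `0`.
    have h2 : Tendsto (fun k => ∫ p, cut k ψ p ∂σ) atTop (𝓝 (L ψ)) := by
      simp_rw [hσint]
      rw [tendsto_iff_dist_tendsto_zero]
      have h3 : Tendsto (fun k => ∫ x, (1 - χ k x) * ‖ψ‖ ∂μ₀) atTop (𝓝 (∫ _, 0 ∂μ₀)) := by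
        refine tendsto_integral_of_dominated_convergence (fun _ => ‖ψ‖)
          (fun k => by
            have := hχc k
            exact Continuous.aestronglyMeasurable (by fun_prop)) (integrable_const _)
          (fun k => Eventually.of_forall fun x => ?_) (Eventually.of_forall fun x => ?_)
        · rw [norm_mul, norm_norm, Real.norm_of_nonneg (sub_nonneg.2 (hχ1 k x))]
          exact mul_le_of_le_one_left (norm_nonneg _) (by linarith [hχ0 k x])
        · refine tendsto_const_nhds.congr' ?_
          filter_upwards [hχlim x] with k hk
          rw [hk, sub_self, zero_mul]
      rw [integral_zero] at h3
      refine squeeze_zero (fun _ => dist_nonneg) (fun k => ?_) h3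
      rw [dist_comm, Real.dist_eq, ← map_sub]
      refine hLabs _ _ (((integrable_const 1).sub (hχint k)).mul_const _) fun x y => ?_
      change |ψ (x, y) - χ k x * ψ (x, y)| ≤ _
      rw [← one_sub_mul, abs_mul, abs_of_nonneg (sub_nonneg.2 (hχ1 k x))]
      exact mul_le_mul_of_nonneg_left (ψ.norm_coe_le_norm _) (sub_nonneg.2 (hχ1 k x))
    exact tendsto_nhds_unique h1 h2
  refine ⟨σ, hfin, ?_, hall⟩
  refine Measure.ext_of_integral_lipschitz fun M v hv hvc => ?_
  have hvcont := hv.continuous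
  obtain ⟨C, hC⟩ := hvcont.bounded_above_of_compact_support hvc
  have hvint : Integrable v μ₀ :=
    Integrable.of_bound hvcont.aestronglyMeasurable C (Eventually.of_forall hC)
  let ψ : X × Y →ᵇ ℝ := BoundedContinuousFunction.ofNormedAddCommGroup (fun p => v p.1)
    (by fun_prop) C (fun p => hC p.1)
  have hψ : ∫ x, v x ∂σ.fst = L ψ := by
    rw [Measure.fst, integral_map measurable_fst.aemeasurable hvcont.aestronglyMeasurable, ← hall]
    rfl
  rw [hψ]
  -- For a function of `x` alone the supremum over `y` is trivial, so the domination of `ψ` and of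
  -- `-ψ` gives equality.
  refine le_antisymm (hLle ψ v hvint fun x y => le_rfl) ?_
  have := hLle (-ψ) (fun x => -v x) hvint.neg fun x y => le_rfl
  rw [map_neg, integral_neg] at this
  linarith

end Duality

/-! ### Optimal stopping and the joint law of initial point and stopping time. -/

section Stopping

variable {X : Type*}

/-- The discounted value `e^{-βs} v(Φ_s x)` at the time `s ∈ [0,∞]`, which is `0` for `s = ∞`. -/
noncomputable def Flow.stopped [TopologicalSpace X] (Φ : Flow ℝ X) (β : ℝ) (v : X → ℝ)
    (p : X × ℝ≥0∞) : ℝ :=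
  if p.2 = ∞ then 0 else Real.exp (-β * p.2.toReal) * v (Φ p.2.toReal p.1)

section

variable [TopologicalSpace X] (Φ : Flow ℝ X) {β : ℝ} {v : X → ℝ}

lemma Flow.abs_stopped_le (hβ : 0 < β) {C : ℝ} (hC : ∀ x, |v x| ≤ C) (p : X × ℝ≥0∞) :
    |Φ.stopped β v p| ≤ C := by
  unfold Flow.stopped
  split_ifs
  · simpa using (abs_nonneg _).trans (hC p.1)
  · rw [abs_mul, abs_of_pos (Real.exp_pos _)]
    refine (mul_le_of_le_one_left (abs_nonneg _) (Real.exp_le_one_iff.2 ?_)).trans (hC _)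
    nlinarith [ENNReal.toReal_nonneg (a := p.2)]

/-- At finite times this is continuity of the flow. At `s = ∞` the payoff is at most `C e^{-βM}`
once `s > M`, uniformly in `x`, so the value `0` there is the continuous one. -/
lemma Flow.continuous_stopped (hβ : 0 < β) (hv : Continuous v) {C : ℝ} (hC : ∀ x, |v x| ≤ C) :
    Continuous (Φ.stopped β v) := by
  refine continuous_iff_continuousAt.2 fun ⟨x, s⟩ => ?_
  by_cases hs : s = ∞
  · subst hs
    have hC0 : 0 ≤ C := (abs_nonneg _).trans (hC x)
    have hval : Φ.stopped β v (x, ∞) = 0 := by simp [Flow.stopped]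
    rw [ContinuousAt, hval]
    have hlim : Tendsto (fun M : ℕ => Real.exp (-β * M) * C) atTop (𝓝 0) := by
      have h1 : Tendsto (fun M : ℕ => -β * (M : ℝ)) atTop atBot :=
        tendsto_natCast_atTop_atTop.const_mul_atTop_of_neg (by linarith)
      simpa using (Real.tendsto_exp_atBot.comp h1).mul_const C
    refine Metric.tendsto_nhds.2 fun ε hε => ?_
    obtain ⟨M, hM⟩ := (hlim.eventually_lt_const hε).exists
    have hnhds : ∀ᶠ p : X × ℝ≥0∞ in 𝓝 (x, ∞), (M : ℝ≥0∞) < p.2 :=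
      (continuous_snd.tendsto (x, ∞)).eventually (lt_mem_nhds (ENNReal.natCast_lt_top M))
    filter_upwards [hnhds] with p hp
    rw [dist_zero_right, Real.norm_eq_abs, Flow.stopped]
    split_ifs with hp'
    · simpa using hε
    · refine lt_of_le_of_lt ?_ hM
      rw [abs_mul, abs_of_pos (Real.exp_pos _)]
      have hMp : (M : ℝ) ≤ p.2.toReal := by
        have := (ENNReal.toReal_le_toReal (ENNReal.natCast_ne_top M) hp').2 hp.le
        simpa using this
      have := hC (Φ p.2.toReal p.1)
      gcongr ?_ * ?_
      refine Real.exp_le_exp.2 ?_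
      nlinarith
  · have h1 : ContinuousAt (fun p : X × ℝ≥0∞ => p.2.toReal) (x, s) :=
      ContinuousAt.comp (f := fun p : X × ℝ≥0∞ => p.2) (g := ENNReal.toReal) (x := (x, s))
        (ENNReal.continuousAt_toReal hs) continuousAt_snd
    have h2 : ContinuousAt (fun p : X × ℝ≥0∞ =>
        Real.exp (-β * p.2.toReal) * v (Φ p.2.toReal p.1)) (x, s) := by
      have hc : Continuous fun q : ℝ × X => Real.exp (-β * q.1) * v (Φ q.1 q.2) := by fun_prop
      exact hc.continuousAt.comp (h1.prodMk continuousAt_fst)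
    refine h2.congr ?_
    have : ∀ᶠ p : X × ℝ≥0∞ in 𝓝 (x, s), p.2 ≠ ∞ :=
      (continuous_snd.tendsto (x, s)).eventually (isOpen_ne.mem_nhds hs)
    filter_upwards [this] with p hp
    simp [Flow.stopped, hp]

lemma Flow.stopped_zero (x : X) : Φ.stopped β v (x, 0) = v x := by
  simp [Flow.stopped]

/-- This shift makes the value function excessive: starting after time `t` amounts to allowing only
stopping times `s + t`. -/
lemma Flow.exp_mul_stopped_apply {t : ℝ} (ht : 0 ≤ t) (x : X) (s : ℝ≥0∞) :
    Real.exp (-β * t) * Φ.stopped β v (Φ t x, s) =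
      Φ.stopped β v (x, s + ENNReal.ofReal t) := by
  by_cases hs : s = ∞
  · simp [Flow.stopped, hs]
  · have h : s + ENNReal.ofReal t ≠ ∞ := by finiteness
    simp only [Flow.stopped, hs, h, if_false]
    rw [ENNReal.toReal_add hs (by finiteness), ENNReal.toReal_ofReal ht, ← Φ.map_add, ← mul_assoc,
      ← Real.exp_add]
    ring_nf

/-- `Flow.stopped` as a bounded continuous function. -/
noncomputable def Flow.stoppedBCF (hβ : 0 < β) (v : X →ᵇ ℝ) : X × ℝ≥0∞ →ᵇ ℝ :=
  BoundedContinuousFunction.ofNormedAddCommGroup (Φ.stopped β v)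
    (Φ.continuous_stopped hβ v.continuous v.norm_coe_le_norm) ‖v‖
    (Φ.abs_stopped_le hβ v.norm_coe_le_norm)

@[simp]
lemma Flow.stoppedBCF_apply (hβ : 0 < β) (v : X →ᵇ ℝ) (p : X × ℝ≥0∞) :
    Φ.stoppedBCF hβ v p = Φ.stopped β v p := rfl

variable [SecondCountableTopology X] [MeasurableSpace X] [BorelSpace X]

/-- Optimal stopping bound for the terminal measure. -/
theorem Flow.integral_le_integral_iSup_stopped (hβ : 0 < β) {μ₀ μ μT : Measure X}
    [IsFiniteMeasure μ₀] [IsFiniteMeasure μ] [IsFiniteMeasure μT]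
    (hres : μ + Φ.resolvent β μT = Φ.resolvent β μ₀) (v : X →ᵇ ℝ) :
    ∫ x, v x ∂μT ≤ ∫ x, (⨆ s, Φ.stoppedBCF hβ v (x, s)) ∂μ₀ := by
  set ψ := Φ.stoppedBCF hβ v with hψ
  have h1 : ∫ x, v x ∂μT ≤ ∫ x, (⨆ s, ψ (x, s)) ∂μT := by
    refine integral_mono (v.integrable _) (ψ.integrable_iSup_section μT) fun x => ?_
    refine le_trans ?_ (le_ciSup (ψ.bddAbove_range_section x) 0)
    simp [hψ, Φ.stopped_zero]
  refine h1.trans (Φ.integral_le_of_excessive hβ hres ψ.continuous_iSup_section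
    ψ.abs_iSup_section_le fun t ht x => ?_)
  rw [Real.mul_iSup_of_nonneg (Real.exp_pos _).le]
  refine ciSup_le fun s => ?_
  rw [hψ, Φ.stoppedBCF_apply, Φ.exp_mul_stopped_apply ht]
  exact le_ciSup (ψ.bddAbove_range_section x) (s + ENNReal.ofReal t)

end

variable [MetricSpace X] [ProperSpace X] [Nonempty X] [MeasurableSpace X] [BorelSpace X]

/-- Existence of a randomized stopping time, as a joint law of initial point and stopping time. -/
theorem Flow.exists_stopping_measure (Φ : Flow ℝ X) {β : ℝ} (hβ : 0 < β) {μ₀ μ μT : Measure X}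
    [IsFiniteMeasure μ₀] [IsFiniteMeasure μ] [IsFiniteMeasure μT]
    (hres : μ + Φ.resolvent β μT = Φ.resolvent β μ₀) :
    ∃ σ : Measure (X × ℝ≥0∞), IsFiniteMeasure σ ∧ σ.fst = μ₀ ∧
      ∀ v : X →ᵇ ℝ, ∫ p, Φ.stopped β v p ∂σ = ∫ x, v x ∂μT := by
  -- Stopping at `s = 0` recovers `v` from its payoff. Thus the payoffs are the fixed points of `ψ ↦
  -- stopped (tr ψ)`, a subspace `S`, and `ℓ` is well defined on it.
  let tr : (X × ℝ≥0∞ →ᵇ ℝ) → (X →ᵇ ℝ) := fun ψ =>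
    ψ.compContinuous ⟨fun x => (x, 0), by fun_prop⟩
  have htr : ∀ ψ x, tr ψ x = ψ (x, 0) := fun _ _ => rfl
  let S : Submodule ℝ (X × ℝ≥0∞ →ᵇ ℝ) :=
    { carrier := {ψ | Φ.stoppedBCF hβ (tr ψ) = ψ}
      zero_mem' := by ext p; simp [Flow.stopped, htr]
      add_mem' := by
        intro a b ha hb
        ext p
        have ha' := DFunLike.congr_fun ha p
        have hb' := DFunLike.congr_fun hb p
        simp only [Flow.stoppedBCF_apply, Flow.stopped, htr, BoundedContinuousFunction.coe_add,
          Pi.add_apply] at ha' hb' ⊢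
        rw [← ha', ← hb']
        split_ifs <;> ring
      smul_mem' := by
        intro c a ha
        ext p
        have ha' := DFunLike.congr_fun ha p
        simp only [Flow.stoppedBCF_apply, Flow.stopped, htr, BoundedContinuousFunction.coe_smul,
          smul_eq_mul] at ha' ⊢
        rw [← ha']
        split_ifs <;> ring }
  let ℓ : (X × ℝ≥0∞ →ᵇ ℝ) →ₗ[ℝ] ℝ :=
    { toFun := fun ψ => ∫ x, tr ψ x ∂μT
      map_add' := fun a b => integral_add ((tr a).integrable _) ((tr b).integrable _)
      map_smul' := fun c a => integral_const_mul c _ }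
  -- Hahn–Banach with the sublinear functional `ψ ↦ ∫ sup_s ψ(x, s) dμ₀`; the domination on `S` is
  -- the optimal stopping bound.
  obtain ⟨L, hLS, hLle⟩ := exists_extension_of_le_sublinear ⟨S, ℓ.domRestrict S⟩
    (fun ψ => ∫ x, (⨆ s, ψ (x, s)) ∂μ₀)
    (fun c hc ψ => by
      rw [← integral_const_mul]
      refine integral_congr_ae (Eventually.of_forall fun x => ?_)
      simp only [BoundedContinuousFunction.coe_smul, smul_eq_mul]
      rw [Real.mul_iSup_of_nonneg hc.le])
    (fun a b => by
      rw [← integral_add (a.integrable_iSup_section μ₀) (b.integrable_iSup_section μ₀)]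
      refine integral_mono ((a + b).integrable_iSup_section μ₀)
        ((a.integrable_iSup_section μ₀).add (b.integrable_iSup_section μ₀)) fun x => ?_
      exact ciSup_le fun s => add_le_add (le_ciSup (a.bddAbove_range_section x) s)
        (le_ciSup (b.bddAbove_range_section x) s))
    (fun ψ => by
      have h := Φ.integral_le_integral_iSup_stopped hβ hres (tr ψ)
      have hψ : Φ.stoppedBCF hβ (tr (ψ : X × ℝ≥0∞ →ᵇ ℝ)) = ψ := ψ.2
      rw [hψ] at h
      exact h)
  obtain ⟨σ, hσf, hσ1, hσ⟩ := exists_measure_of_forall_le_integral_iSup μ₀ L hLle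
  refine ⟨σ, hσf, hσ1, fun v => ?_⟩
  have htrv : tr (Φ.stoppedBCF hβ v) = v := by
    ext x
    simp [htr, Φ.stopped_zero]
  have hmem : Φ.stoppedBCF hβ v ∈ S := by
    change Φ.stoppedBCF hβ (tr _) = _
    rw [htrv]
  have h1 := hσ (Φ.stoppedBCF hβ v)
  have h2 : L (Φ.stoppedBCF hβ v) = ∫ x, tr (Φ.stoppedBCF hβ v) x ∂μT := hLS ⟨_, hmem⟩
  rw [htrv] at h2
  exact h1.trans h2

end Stopping

/-! ### Occupation and terminal measures of a randomized stopping time. -/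

section Representation

lemma measurableSet_timesUpTo (s : ℝ≥0∞) : MeasurableSet (timesUpTo s) :=
  (measurableSet_Ici (a := (0 : ℝ))).inter (ENNReal.measurable_ofReal measurableSet_Iic)

lemma timesUpTo_eq_inter (s : ℝ≥0∞) : timesUpTo s = Ici 0 ∩ {t | ENNReal.ofReal t ≤ s} := rfl

lemma timesUpTo_of_ne_top {s : ℝ≥0∞} (hs : s ≠ ∞) : timesUpTo s = Icc 0 s.toReal := by
  ext t
  simp only [timesUpTo, mem_Icc, ENNReal.ofReal_le_iff_le_toReal hs]
  rfl

/-- The discount factor `e^{-βs}` at the time `s ∈ [0,∞]`, which is `0` for `s = ∞`. -/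
noncomputable def discountFactor (β : ℝ) (s : ℝ≥0∞) : ℝ≥0∞ :=
  if s = ∞ then 0 else ENNReal.ofReal (Real.exp (-β * s.toReal))

lemma measurable_discountFactor (β : ℝ) : Measurable (discountFactor β) :=
  Measurable.ite (measurableSet_singleton _) measurable_const (by fun_prop)

lemma discountFactor_le_one {β : ℝ} (hβ : 0 < β) (s : ℝ≥0∞) : discountFactor β s ≤ 1 := by
  unfold discountFactor
  split_ifs
  · exact zero_le_one
  · rw [ENNReal.ofReal_le_one]
    exact Real.exp_le_one_iff.2 (by nlinarith [ENNReal.toReal_nonneg (a := s)])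

lemma lintegral_discountMeasure (β : ℝ) {h : ℝ → ℝ≥0∞} (hh : Measurable h) :
    ∫⁻ t, h t ∂(discountMeasure β) =
      ∫⁻ t in Ici 0, ENNReal.ofReal (Real.exp (-β * t)) * h t := by
  rw [discountMeasure, lintegral_withDensity_eq_lintegral_mul _ (measurable_discount β) hh]
  rfl

/-- The discounted time splits at a stopping time. -/
lemma lintegral_discountMeasure_split (β : ℝ) {h : ℝ → ℝ≥0∞} (hh : Measurable h) (s : ℝ≥0∞) :
    (∫⁻ t, {t | ENNReal.ofReal t ≤ s}.indicator h t ∂(discountMeasure β)) +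
      discountFactor β s * ∫⁻ t, h (t + s.toReal) ∂(discountMeasure β) =
    ∫⁻ t, h t ∂(discountMeasure β) := by
  by_cases hs : s = ∞
  · simp [hs, discountFactor]
  have hset : MeasurableSet {t : ℝ | ENNReal.ofReal t ≤ s} :=
    ENNReal.measurable_ofReal measurableSet_Iic
  have hm : Measurable fun t => ENNReal.ofReal (Real.exp (-β * t)) * h t :=
    (measurable_discount β).mul hh
  set r := s.toReal with hr
  have hr0 : 0 ≤ r := ENNReal.toReal_nonneg
  have h1 : ∫⁻ t, {t | ENNReal.ofReal t ≤ s}.indicator h t ∂(discountMeasure β) =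
      ∫⁻ t in Icc 0 r, ENNReal.ofReal (Real.exp (-β * t)) * h t := by
    rw [lintegral_discountMeasure β (hh.indicator hset), ← timesUpTo_of_ne_top hs,
      timesUpTo_eq_inter, inter_comm, ← Measure.restrict_restrict hset, ← lintegral_indicator hset]
    refine lintegral_congr fun t => ?_
    by_cases ht : t ∈ {t : ℝ | ENNReal.ofReal t ≤ s}
    · rw [indicator_of_mem ht, indicator_of_mem ht]
    · rw [indicator_of_notMem ht, indicator_of_notMem ht, mul_zero]
  -- Translation by `r`: the factor `e^{-βr}` merges with `e^{-βt}` into the discount at time `t +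
  -- r`.
  have h2 : discountFactor β s * ∫⁻ t, h (t + r) ∂(discountMeasure β) =
      ∫⁻ t in Ioi r, ENNReal.ofReal (Real.exp (-β * t)) * h t := by
    have hhr : Measurable fun t => h (t + r) := hh.comp (measurable_id.add_const r)
    have hmr : Measurable fun t => ENNReal.ofReal (Real.exp (-β * t)) * h (t + r) :=
      (measurable_discount β).mul hhr
    rw [lintegral_discountMeasure β hhr, ← lintegral_const_mul _ hmr,
      setLIntegral_congr Ioi_ae_eq_Ici]
    have := (measurePreserving_add_right volume r).setLIntegral_comp_preimage
      (measurableSet_Ici (a := r)) hm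
    rw [preimage_add_const_Ici, sub_self] at this
    rw [← this]
    refine lintegral_congr fun t => ?_
    rw [discountFactor, if_neg hs, ← mul_assoc, ← ENNReal.ofReal_mul (Real.exp_pos _).le,
      ← Real.exp_add, ← hr, ← mul_add, add_comm r t]
  rw [h1, h2, lintegral_discountMeasure β hh, ← lintegral_union measurableSet_Ioi,
    Icc_union_Ioi_eq_Ici hr0]
  exact Set.disjoint_left.2 fun t ht ht' => (not_lt.2 ht.2) ht'

lemma measurable_discountFactor_snd {X : Type*} [MeasurableSpace X] {β : ℝ} :
    Measurable fun p : X × ℝ≥0∞ => discountFactor β p.2 :=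
  (measurable_discountFactor β).comp measurable_snd

lemma measurableSet_ofReal_le_time {X : Type*} [MeasurableSpace X] :
    MeasurableSet {q : (X × ℝ≥0∞) × ℝ | ENNReal.ofReal q.2 ≤ q.1.2} :=
  measurableSet_le (by fun_prop) (by fun_prop)

variable {X : Type*} [TopologicalSpace X] (Φ : Flow ℝ X) {β : ℝ}

lemma discountFactor_toReal_mul_eq_stopped (v : X → ℝ) (p : X × ℝ≥0∞) :
    (discountFactor β p.2).toReal • v (Φ p.2.toReal p.1) = Φ.stopped β v p := by
  unfold discountFactor Flow.stopped
  split_ifs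
  · simp
  · rw [ENNReal.toReal_ofReal (Real.exp_pos _).le, smul_eq_mul]

variable [MeasurableSpace X] (β) in
/-- The law of the state at a randomized stopping time with discounting. -/
noncomputable def Flow.terminalMeasure (σ : Measure (X × ℝ≥0∞)) : Measure X :=
  (σ.withDensity fun p => discountFactor β p.2).map fun p => Φ p.2.toReal p.1

variable [MeasurableSpace X] (β) in
/-- The discounted occupation measure up to a randomized stopping time. -/
noncomputable def Flow.occupationMeasure (σ : Measure (X × ℝ≥0∞)) : Measure X :=
  ((σ.prod (discountMeasure β)).restrict {q | ENNReal.ofReal q.2 ≤ q.1.2}).map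
    fun q => Φ q.2 q.1.1

variable [MeasurableSpace X] (σ : Measure (X × ℝ≥0∞))

lemma Flow.isFiniteMeasure_terminalMeasure [IsFiniteMeasure σ] (hβ : 0 < β) :
    IsFiniteMeasure (Φ.terminalMeasure β σ) := by
  have : IsFiniteMeasure (σ.withDensity fun p => discountFactor β p.2) :=
    isFiniteMeasure_withDensity <| ne_of_lt <|
      (lintegral_mono (g := fun _ => 1) fun p : X × ℝ≥0∞ => discountFactor_le_one hβ p.2).trans_lt
        (by simp)
  unfold Flow.terminalMeasure
  infer_instance

lemma Flow.isFiniteMeasure_occupationMeasure [IsFiniteMeasure σ] (hβ : 0 < β) :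
    IsFiniteMeasure (Φ.occupationMeasure β σ) := by
  have := isFiniteMeasure_discountMeasure hβ
  unfold Flow.occupationMeasure
  infer_instance

variable [BorelSpace X]

lemma Flow.measurable_terminal [SecondCountableTopology X] :
    Measurable fun p : X × ℝ≥0∞ => Φ p.2.toReal p.1 :=
  Φ.continuous_swap.measurable.comp
    (measurable_fst.prodMk (ENNReal.measurable_toReal.comp measurable_snd))

lemma Flow.measurable_occupation [SecondCountableTopology X] :
    Measurable fun q : (X × ℝ≥0∞) × ℝ => Φ q.2 q.1.1 :=
  Φ.continuous_swap.measurable.comp (measurable_fst.fst.prodMk measurable_snd)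

variable [SecondCountableTopology X]

lemma Flow.integral_terminalMeasure {v : X → ℝ} (hβ : 0 < β)
    (hv : AEStronglyMeasurable v (Φ.terminalMeasure β σ)) :
    ∫ x, v x ∂(Φ.terminalMeasure β σ) = ∫ p, Φ.stopped β v p ∂σ := by
  have hm := Φ.measurable_terminal
  rw [Flow.terminalMeasure, integral_map hm.aemeasurable hv,
    integral_withDensity_eq_integral_toReal_smul
      measurable_discountFactor_snd
      (Eventually.of_forall fun p => (discountFactor_le_one hβ p.2).trans_lt ENNReal.one_lt_top)]
  exact integral_congr_ae (Eventually.of_forall fun p =>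
    discountFactor_toReal_mul_eq_stopped Φ v p)

lemma Flow.integrable_stopped {v : X → ℝ} (hβ : 0 < β)
    (hv : Integrable v (Φ.terminalMeasure β σ)) : Integrable (Φ.stopped β v) σ := by
  have hm := Φ.measurable_terminal
  have h1 := hv.comp_measurable hm
  rw [integrable_withDensity_iff_integrable_smul'
      measurable_discountFactor_snd
      (Eventually.of_forall fun p => (discountFactor_le_one hβ p.2).trans_lt ENNReal.one_lt_top)]
    at h1
  exact h1.congr (Eventually.of_forall fun p => discountFactor_toReal_mul_eq_stopped Φ v p)

/-- Strong Markov property of the flow at a randomized stopping time. -/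
theorem Flow.occupationMeasure_add_resolvent [IsFiniteMeasure σ] (hβ : 0 < β) :
    Φ.occupationMeasure β σ + Φ.resolvent β (Φ.terminalMeasure β σ) = Φ.resolvent β σ.fst := by
  have := isFiniteMeasure_discountMeasure hβ
  have hTf := Φ.isFiniteMeasure_terminalMeasure σ hβ
  ext B hB
  set h : X → ℝ≥0∞ := B.indicator 1 with hh
  have hhm : Measurable h := measurable_one.indicator hB
  have hΦm : Measurable fun p : X × ℝ => Φ p.2 p.1 := Φ.continuous_swap.measurable
  have hhΦ : Measurable fun p : X × ℝ => h (Φ p.2 p.1) := hhm.comp hΦm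
  have hhO : Measurable fun q : (X × ℝ≥0∞) × ℝ => h (Φ q.2 q.1.1) :=
    hhm.comp Φ.measurable_occupation
  have hres : ∀ (m : Measure X) [IsFiniteMeasure m],
      Φ.resolvent β m B = ∫⁻ x, ∫⁻ t, h (Φ t x) ∂(discountMeasure β) ∂m := by
    intro m _
    rw [← lintegral_indicator_one hB, Flow.resolvent, lintegral_map hhm hΦm,
      lintegral_prod _ hhΦ.aemeasurable]
  have hinner : Measurable fun x => ∫⁻ t, h (Φ t x) ∂(discountMeasure β) :=
    hhΦ.lintegral_prod_right'
  have hinnerT : Measurable fun p : X × ℝ≥0∞ =>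
      ∫⁻ t, h (Φ t (Φ p.2.toReal p.1)) ∂(discountMeasure β) := hinner.comp Φ.measurable_terminal
  have hocc : Φ.occupationMeasure β σ B = ∫⁻ p, ∫⁻ t,
      {t | ENNReal.ofReal t ≤ p.2}.indicator (fun t => h (Φ t p.1)) t ∂(discountMeasure β) ∂σ := by
    rw [← lintegral_indicator_one hB, Flow.occupationMeasure,
      lintegral_map hhm Φ.measurable_occupation, ← lintegral_indicator measurableSet_ofReal_le_time,
      lintegral_prod _ (hhO.indicator measurableSet_ofReal_le_time).aemeasurable]
    rfl
  rw [Measure.add_apply, hocc, hres, hres, Flow.terminalMeasure,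
    lintegral_map hinner Φ.measurable_terminal, lintegral_withDensity_eq_lintegral_mul _
      measurable_discountFactor_snd hinnerT,
    Measure.fst, lintegral_map hinner measurable_fst, ← lintegral_add_right]
  -- For each pair of initial point and stopping time, the unstopped orbit splits at that time; the
  -- part after it is the orbit restarted from the stopped state.
  · refine lintegral_congr fun p => ?_
    have hp : Measurable fun t => h (Φ t p.1) :=
      hhm.comp (Φ.continuous continuous_id continuous_const).measurable
    rw [← lintegral_discountMeasure_split β hp p.2]
    simp only [Pi.mul_apply, Φ.map_add]
  · exact measurable_discountFactor_snd.mul hinnerT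

lemma Flow.integrable_occupation {v : X → ℝ} (hv : Integrable v (Φ.occupationMeasure β σ)) :
    Integrable ({q : (X × ℝ≥0∞) × ℝ | ENNReal.ofReal q.2 ≤ q.1.2}.indicator
      fun q => v (Φ q.2 q.1.1)) (σ.prod (discountMeasure β)) :=
  (integrable_indicator_iff measurableSet_ofReal_le_time).2
    (hv.comp_measurable Φ.measurable_occupation)

lemma integral_discountMeasure_indicator (β : ℝ) (g : ℝ → ℝ) (s : ℝ≥0∞) :
    ∫ t, {t | ENNReal.ofReal t ≤ s}.indicator g t ∂(discountMeasure β) =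
      ∫ t in timesUpTo s, Real.exp (-β * t) * g t := by
  have hset : MeasurableSet {t : ℝ | ENNReal.ofReal t ≤ s} :=
    ENNReal.measurable_ofReal measurableSet_Iic
  rw [integral_discountMeasure, timesUpTo_eq_inter, inter_comm, ← Measure.restrict_restrict hset,
    ← integral_indicator hset]
  refine integral_congr_ae (Eventually.of_forall fun t => ?_)
  by_cases ht : t ∈ {t : ℝ | ENNReal.ofReal t ≤ s}
  · simp only [indicator_of_mem ht]
  · simp only [indicator_of_notMem ht, mul_zero]

lemma Flow.integral_occupationMeasure [IsFiniteMeasure σ] {v : X → ℝ} (hβ : 0 < β)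
    (hv : Integrable v (Φ.occupationMeasure β σ)) :
    Integrable (fun p : X × ℝ≥0∞ => ∫ t in timesUpTo p.2, Real.exp (-β * t) * v (Φ t p.1)) σ ∧
    ∫ x, v x ∂(Φ.occupationMeasure β σ) =
      ∫ p, (∫ t in timesUpTo p.2, Real.exp (-β * t) * v (Φ t p.1)) ∂σ := by
  have := isFiniteMeasure_discountMeasure hβ
  have hi := Φ.integrable_occupation σ hv
  have hinner : ∀ p : X × ℝ≥0∞, ∫ t, {q : (X × ℝ≥0∞) × ℝ | ENNReal.ofReal q.2 ≤ q.1.2}.indicator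
      (fun q => v (Φ q.2 q.1.1)) (p, t) ∂(discountMeasure β) =
      ∫ t in timesUpTo p.2, Real.exp (-β * t) * v (Φ t p.1) := fun p =>
    integral_discountMeasure_indicator β (fun t => v (Φ t p.1)) p.2
  constructor
  · simpa only [hinner] using hi.integral_prod_left
  · rw [Flow.occupationMeasure, integral_map Φ.measurable_occupation.aemeasurable
      hv.aestronglyMeasurable, ← integral_indicator measurableSet_ofReal_le_time, integral_prod _ hi]
    simp only [hinner]

/-- The density `e^{-βt}` is positive, so discounted null sets of nonnegative times are Lebesgue
null. -/
lemma ae_timesUpTo_of_ae_discountMeasure {P : ℝ → Prop} {s : ℝ≥0∞}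
    (h : ∀ᵐ t ∂(discountMeasure β), ENNReal.ofReal t ≤ s → P t) :
    ∀ᵐ t ∂(volume.restrict (timesUpTo s)), P t := by
  rw [discountMeasure, ae_withDensity_iff (measurable_discount β),
    ae_restrict_iff' measurableSet_Ici] at h
  rw [ae_restrict_iff' (measurableSet_timesUpTo s)]
  filter_upwards [h] with t ht hts
  exact ht hts.1 (by simp [Real.exp_pos]) hts.2

lemma Flow.ae_occupation_notMem {B : Set X} (hB : Φ.occupationMeasure β σ B = 0) (hβ : 0 < β) :
    ∀ᵐ p ∂σ, ∀ᵐ t ∂(volume.restrict (timesUpTo p.2)), Φ t p.1 ∉ B := by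
  have := isFiniteMeasure_discountMeasure hβ
  have h1 : ∀ᵐ x ∂(Φ.occupationMeasure β σ), x ∉ B := measure_eq_zero_iff_ae_notMem.1 hB
  have h2 := ae_of_ae_map Φ.measurable_occupation.aemeasurable h1
  rw [ae_restrict_iff' measurableSet_ofReal_le_time] at h2
  filter_upwards [Measure.ae_ae_of_ae_prod h2] with p hp
  exact ae_timesUpTo_of_ae_discountMeasure hp

end Representation

/-! ### Disintegration into a stopping kernel. -/

section StoppingKernel

variable {X : Type*} [MetricSpace X] [ProperSpace X] [Nonempty X] [MeasurableSpace X]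
  [BorelSpace X]

/-- Measures related by the resolvent of a flow are the initial, occupation and terminal measure
of a randomized stopping time. -/
theorem Flow.exists_stopping_kernel (Φ : Flow ℝ X) {β : ℝ} (hβ : 0 < β) {μ₀ μ μT : Measure X}
    [IsFiniteMeasure μ₀] [IsFiniteMeasure μ] [IsFiniteMeasure μT]
    (hres : μ + Φ.resolvent β μT = Φ.resolvent β μ₀) :
    ∃ τ : Kernel X ℝ≥0∞, IsMarkovKernel τ ∧
      (∀ v : X → ℝ, Integrable v μ → ∫ x, v x ∂μ =
        ∫ x, (∫ s, (∫ t in timesUpTo s, Real.exp (-β * t) * v (Φ t x)) ∂(τ x)) ∂μ₀) ∧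
      (∀ v : X → ℝ, Integrable v μT → ∫ x, v x ∂μT =
        ∫ x, (∫ s, Φ.stopped β v (x, s) ∂(τ x)) ∂μ₀) ∧
      ∀ B, μ B = 0 → ∀ᵐ x ∂μ₀, ∀ᵐ s ∂(τ x),
        ∀ᵐ t ∂(volume.restrict (timesUpTo s)), Φ t x ∉ B := by
  obtain ⟨σ, hσf, hσ1, hσ⟩ := Φ.exists_stopping_measure hβ hres
  have hTf := Φ.isFiniteMeasure_terminalMeasure σ hβ
  have hOf := Φ.isFiniteMeasure_occupationMeasure σ hβ
  have hT : Φ.terminalMeasure β σ = μT := by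
    refine Measure.ext_of_integral_lipschitz fun L v hv hvc => ?_
    obtain ⟨C, hC⟩ := hv.continuous.bounded_above_of_compact_support hvc
    rw [Φ.integral_terminalMeasure σ hβ hv.continuous.aestronglyMeasurable]
    exact hσ (BoundedContinuousFunction.ofNormedAddCommGroup v hv.continuous C hC)
  -- Nothing in the construction of `σ` prescribes its occupation measure; it is forced by
  -- cancelling the finite resolvent of `μT`.
  have hO : Φ.occupationMeasure β σ = μ := by
    have h1 := Φ.occupationMeasure_add_resolvent σ hβ
    rw [hT, hσ1, ← hres] at h1
    have := Φ.isFiniteMeasure_resolvent hβ μT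
    ext B hB
    have h2 := congrArg (fun m : Measure X => m B) h1
    simp only [Measure.add_apply] at h2
    exact (ENNReal.add_left_inj (measure_ne_top _ B)).1 h2
  have hdis : μ₀ ⊗ₘ σ.condKernel = σ := by
    rw [← hσ1]
    exact σ.disintegrate σ.condKernel
  refine ⟨σ.condKernel, inferInstance, fun v hv => ?_, fun v hv => ?_, fun B hB => ?_⟩
  · rw [← hO] at hv ⊢
    obtain ⟨hi, h⟩ := Φ.integral_occupationMeasure σ hβ hv
    rw [← hdis] at hi
    rw [h, ← Measure.integral_compProd hi, hdis]
  · rw [← hT] at hv ⊢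
    have hi := Φ.integrable_stopped σ hβ hv
    rw [← hdis] at hi
    rw [Φ.integral_terminalMeasure σ hβ hv.aestronglyMeasurable, ← Measure.integral_compProd hi,
      hdis]
  · rw [← hO] at hB
    have h := Φ.ae_occupation_notMem σ hB hβ
    rw [← hdis] at h
    exact Measure.ae_ae_of_ae_compProd h

end StoppingKernel

/-! ### Remaining in a closed set up to the stopping time. -/

section Viability

/-- A continuous curve that lies in a closed set for almost all times up to almost every stopping
time lies in it at all times up to every stopping time in the support. -/
lemma forall_mem_of_ae_timesUpTo {X : Type*} [TopologicalSpace X] {y : ℝ → X} (hy : Continuous y)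
    {C : Set X} (hC : IsClosed C) (h0 : y 0 ∈ C) {m : Measure ℝ≥0∞}
    (h : ∀ᵐ s ∂m, ∀ᵐ t ∂(volume.restrict (timesUpTo s)), y t ∈ C) :
    ∀ s ∈ m.support, ∀ t ∈ timesUpTo s, y t ∈ C := by
  -- Being outside `C` is an open condition, so it persists on an interval just before `t`; `t > 0`
  -- because `y 0 ∈ C`. The interval has positive length, which also contradicts an
  -- almost-everywhere statement.
  have hexit : ∀ t : ℝ, 0 ≤ t → y t ∉ C → ∃ a ∈ Ico 0 t, ∀ r ∈ Ioc a t, y r ∉ C := by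
    intro t ht hyt
    have htpos : 0 < t := ht.lt_of_ne fun h => hyt (h ▸ h0)
    exact exists_Ioc_subset_of_mem_nhds' ((hC.preimage hy).isOpen_compl.mem_nhds hyt) htpos
  have hclosed : IsClosed {s : ℝ≥0∞ | ∀ t ∈ timesUpTo s, y t ∈ C} := by
    have : {s : ℝ≥0∞ | ∀ t ∈ timesUpTo s, y t ∈ C}ᶜ =
        ⋃ r ∈ {r : ℝ | 0 ≤ r ∧ y r ∉ C}, Ioi (ENNReal.ofReal r) := by
      ext s
      simp only [mem_compl_iff, mem_ofPred_eq, not_forall, mem_iUnion, mem_Ioi, exists_prop]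
      constructor
      · rintro ⟨t, ht, hyt⟩
        obtain ⟨a, ha, har⟩ := hexit t ht.1 hyt
        have hat := ha.2
        -- An exit time strictly before `s` is needed to write the complement as a union of open
        -- rays.
        refine ⟨(a + t) / 2, ⟨by linarith [ha.1, ht.1], har _ ⟨by linarith, by linarith⟩⟩, ?_⟩
        refine lt_of_lt_of_le ?_ ht.2
        exact (ENNReal.ofReal_lt_ofReal_iff (ha.1.trans_lt hat)).2 (by linarith)
      · rintro ⟨r, ⟨hr0, hyr⟩, hrs⟩
        exact ⟨r, ⟨hr0, hrs.le⟩, hyr⟩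
    rw [← isOpen_compl_iff, this]
    exact isOpen_biUnion fun r _ => isOpen_Ioi
  refine Measure.support_subset_of_isClosed hclosed ?_
  filter_upwards [h] with s hs t ht
  by_contra hyt
  obtain ⟨a, ha, har⟩ := hexit t ht.1 hyt
  have hsub : Ioc a t ⊆ timesUpTo s := fun r hr =>
    ⟨ha.1.trans hr.1.le, (ENNReal.ofReal_le_ofReal hr.2).trans ht.2⟩
  have hs' := ae_restrict_of_ae_restrict_of_subset hsub hs
  rw [ae_restrict_iff' measurableSet_Ioc] at hs'
  have hnull : volume (Ioc a t) = 0 := by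
    rw [measure_eq_zero_iff_ae_notMem]
    filter_upwards [hs'] with r hr hr'
    exact har r hr' (hr hr')
  rw [Real.volume_Ioc, ENNReal.ofReal_eq_zero] at hnull
  linarith [ha.2]

end Viability

/-! ### Regularity of the closed-loop field. -/

section ControlAffine

variable {n m : ℕ}

lemma contDiff_polyField (p : Fin n → MvPolynomial (Fin n) ℝ) : ContDiff ℝ 1 (polyField p) := by
  refine contDiff_euclidean.2 fun k => ?_
  have := (AnalyticOnNhd.eval_continuousLinearMap'
    (fun j : Fin n => (EuclideanSpace.proj j : State n →L[ℝ] ℝ)) (p k)).contDiff (n := 1)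
  exact this

lemma isClosed_semialgSet {k : ℕ} (g : Fin k → MvPolynomial (Fin n) ℝ) :
    IsClosed (semialgSet g) := by
  have : semialgSet g = ⋂ j, {x | 0 ≤ MvPolynomial.eval (fun l => x l) (g j)} := by
    ext x
    simp [semialgSet]
  rw [this]
  refine isClosed_iInter fun j => isClosed_le continuous_const ?_
  exact (MvPolynomial.continuous_eval (g j)).comp (by fun_prop)

/-- The field is a `C¹` map of the pair `(x, u)` composed with the Lipschitz graph `x ↦ (x, u x)`,
hence locally Lipschitz, and compactness makes the constant uniform. -/
lemma exists_lipschitzOnWith_closedLoop (f : Fin n → MvPolynomial (Fin n) ℝ)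
    (fu : Fin m → Fin n → MvPolynomial (Fin n) ℝ) {u : State n → EuclideanSpace ℝ (Fin m)}
    {K : ℝ≥0} (hu : LipschitzWith K u) {C : Set (State n)} (hC : IsCompact C) :
    ∃ K', LipschitzOnWith K' (closedLoop f fu u) C := by
  let G : State n × EuclideanSpace ℝ (Fin m) → State n := fun q =>
    polyField f q.1 + ∑ i, q.2 i • polyField (fu i) q.1
  have hG : ContDiff ℝ 1 G := by
    refine ((contDiff_polyField f).comp contDiff_fst).add (ContDiff.sum fun i _ => ?_)
    have hi : ContDiff ℝ 1 fun q : State n × EuclideanSpace ℝ (Fin m) => q.2 i :=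
      (EuclideanSpace.proj i : EuclideanSpace ℝ (Fin m) →L[ℝ] ℝ).contDiff.comp contDiff_snd
    exact hi.smul ((contDiff_polyField (fu i)).comp contDiff_fst)
  have hloc : LocallyLipschitz (G ∘ fun x => (x, u x)) :=
    hG.locallyLipschitz.comp (LocallyLipschitz.id.prodMk hu.locallyLipschitz)
  exact hloc.locallyLipschitzOn.exists_lipschitzOnWith_of_compact hC

lemma integrable_fderiv_apply {E : Type*} [NormedAddCommGroup E] [NormedSpace ℝ E]
    [MeasurableSpace E] [BorelSpace E] {μ : Measure E} [IsFiniteMeasure μ] {v : E → ℝ}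
    (hv : ContDiff ℝ 1 v) (hvc : HasCompactSupport v) {G : E → E} (hG : Continuous G) :
    Integrable (fun x => fderiv ℝ v x (G x)) μ := by
  refine Continuous.integrable_of_hasCompactSupport
    ((hv.continuous_fderiv one_ne_zero).clm_apply hG) ?_
  refine HasCompactSupport.intro hvc.isCompact fun x hx => ?_
  have : fderiv ℝ v x = 0 := by
    by_contra hne
    exact hx (support_fderiv_subset ℝ hne)
  simp [this]

end ControlAffine

/-! ### Superposition principle and the controlled case. -/

section MainTheorem

variable {n : ℕ} {β : ℝ}

/-- Superposition principle for the discounted Liouville equation of a Lipschitz vector field. -/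
theorem exists_flow_stopping_kernel (hβ : 0 < β) {K : ℝ≥0} {F : State n → State n}
    (hF : LipschitzWith K F) {μ₀ μ μT : Measure (State n)} [IsFiniteMeasure μ₀]
    [IsFiniteMeasure μ] [IsFiniteMeasure μT]
    (hL : ∀ v : State n → ℝ, ContDiff ℝ 1 v → HasCompactSupport v →
      ∫ x, v x ∂μT = (∫ x, v x ∂μ₀) + ∫ x, (fderiv ℝ v x (F x) - β * v x) ∂μ) :
    ∃ (τ : Kernel (State n) ℝ≥0∞) (Φ : Flow ℝ (State n)), IsMarkovKernel τ ∧
      (∀ x t, HasDerivAt (fun s => Φ s x) (F (Φ t x)) t) ∧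
      (∀ v : State n → ℝ, Integrable v μ →
        ∫ y, v y ∂μ = occupationIntegral β μ₀ τ (fun x t => Φ t x) v) ∧
      (∀ v : State n → ℝ, Integrable v μT →
        ∫ y, v y ∂μT = terminalIntegral β μ₀ τ (fun x t => Φ t x) v) ∧
      ∀ B, μ B = 0 → ∀ᵐ x ∂μ₀, ∀ᵐ s ∂(τ x),
        ∀ᵐ t ∂(volume.restrict (timesUpTo s)), Φ t x ∉ B := by
  obtain ⟨Φ, hΦ, hΦL⟩ := hF.exists_flow
  obtain ⟨τ, hτ, hocc, hter, hae⟩ := Φ.exists_stopping_kernel hβ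
    (add_resolvent_eq_resolvent_of_liouville Φ hF.continuous hΦ hΦL hβ hL)
  exact ⟨τ, Φ, hτ, hΦ, hocc, hter, hae⟩

/-- The control form of the Liouville equation is the one of any vector field that agrees with the
closed loop on a set of full measure. -/
lemma liouville_of_control {m : ℕ} {f : Fin n → MvPolynomial (Fin n) ℝ}
    {fu : Fin m → Fin n → MvPolynomial (Fin n) ℝ} {u : State n → EuclideanSpace ℝ (Fin m)}
    (hu : Continuous u) {F : State n → State n} {μ : Measure (State n)} [IsFiniteMeasure μ]
    (hF : ∀ᵐ x ∂μ, F x = closedLoop f fu u x) (hpos : ∀ᵐ x ∂μ, ∀ i, 0 ≤ u x i)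
    {v : State n → ℝ} (hv : ContDiff ℝ 1 v) (hvc : HasCompactSupport v) :
    (∫ x, (fderiv ℝ v x (polyField f x) - β * v x) ∂μ) + ∑ i, ∫ x, fderiv ℝ v x
        (polyField (fu i) x) ∂(μ.withDensity fun x => ENNReal.ofReal (u x i)) =
      ∫ x, (fderiv ℝ v x (F x) - β * v x) ∂μ := by
  have hui : ∀ i, Continuous fun x => u x i := fun i => by fun_prop
  have hp := (contDiff_polyField f).continuous
  have hpu := fun i => (contDiff_polyField (fu i)).continuous
  have hν : ∀ i, ∫ x, fderiv ℝ v x (polyField (fu i) x)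
      ∂(μ.withDensity fun x => ENNReal.ofReal (u x i)) =
      ∫ x, fderiv ℝ v x (u x i • polyField (fu i) x) ∂μ := by
    intro i
    rw [integral_withDensity_eq_integral_toReal_smul (hui i).measurable.ennreal_ofReal
      (Eventually.of_forall fun _ => ENNReal.ofReal_lt_top)]
    refine integral_congr_ae ?_
    filter_upwards [hpos] with x hx
    rw [ENNReal.toReal_ofReal (hx i), map_smul]
  have hi0 : Integrable (fun x => fderiv ℝ v x (polyField f x) - β * v x) μ :=
    (integrable_fderiv_apply hv hvc hp).sub
      ((hv.continuous.integrable_of_hasCompactSupport hvc).const_mul β)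
  have hii : ∀ i, Integrable (fun x => fderiv ℝ v x (u x i • polyField (fu i) x)) μ := fun i =>
    integrable_fderiv_apply hv hvc ((hui i).smul (hpu i))
  simp_rw [hν]
  rw [← integral_finsetSum _ fun i _ => hii i,
    ← integral_add hi0 (integrable_finsetSum _ fun i _ => hii i)]
  refine integral_congr_ae ?_
  filter_upwards [hF] with x hx
  rw [hx, closedLoop, map_add, map_sum]
  ring

end MainTheorem

theorem theorem2 (n : ℕ) (β : ℝ) (hβ : 0 < β) :
    -- general form: a globally Lipschitz vector field on `ℝⁿ`
    (∀ (K : ℝ≥0) (F : State n → State n), LipschitzWith K F →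
      ∀ (μ₀ μ μT : Measure (State n)) [IsFiniteMeasure μ₀] [IsFiniteMeasure μ]
        [IsFiniteMeasure μT],
      (∀ v : State n → ℝ, ContDiff ℝ 1 v → HasCompactSupport v →
        ∫ x, v x ∂μT = (∫ x, v x ∂μ₀) + ∫ x, (fderiv ℝ v x (F x) - β * v x) ∂μ) →
      ∃ (τ : Kernel (State n) ℝ≥0∞) (x : State n → ℝ → State n),
        IsMarkovKernel τ ∧
        (∀ x₀, IsTrajectoryUpTo F x₀ ∞ (x x₀)) ∧
        (∀ v : State n → ℝ, Integrable v μ₀ → ∫ y, v y ∂μ₀ = ∫ x₀, v (x x₀ 0) ∂μ₀) ∧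
        (∀ v : State n → ℝ, Integrable v μ → ∫ y, v y ∂μ = occupationIntegral β μ₀ τ x v) ∧
        (∀ v : State n → ℝ, Integrable v μT →
          ∫ y, v y ∂μT = terminalIntegral β μ₀ τ x v)) ∧
    -- control version: polynomial input-affine system, compact semialgebraic state constraint
    (∀ (m k : ℕ) (f : Fin n → MvPolynomial (Fin n) ℝ)
      (fu : Fin m → Fin n → MvPolynomial (Fin n) ℝ)
      (g : Fin k → MvPolynomial (Fin n) ℝ) (ubar : ℝ) (K : ℝ≥0)
      (u : State n → EuclideanSpace ℝ (Fin m)),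
      IsCompact (semialgSet g) →
      LipschitzOnWith K u (semialgSet g) →
      MapsTo u (semialgSet g) (inputBox m ubar) →
      ∀ (μ₀ μ μT : Measure (State n)) [IsFiniteMeasure μ₀] [IsFiniteMeasure μ]
        [IsFiniteMeasure μT] (ν : Fin m → Measure (State n)),
      μ₀.support ⊆ semialgSet g → μ.support ⊆ semialgSet g → μT.support ⊆ semialgSet g →
      (∀ i, ν i = μ.withDensity fun x => ENNReal.ofReal (u x i)) →
      (∀ v : State n → ℝ, ContDiff ℝ 1 v →
        ∫ x, v x ∂μT = (∫ x, v x ∂μ₀) + (∫ x, (fderiv ℝ v x (polyField f x) - β * v x) ∂μ)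
          + ∑ i, ∫ x, fderiv ℝ v x (polyField (fu i) x) ∂(ν i)) →
      ∃ (τ : Kernel (State n) ℝ≥0∞) (x : State n → ℝ → State n),
        IsMarkovKernel τ ∧
        (∀ x₀ ∈ semialgSet g, x x₀ 0 = x₀ ∧ ∀ s ∈ (τ x₀).support,
          IsTrajectoryUpTo (closedLoop f fu u) x₀ s (x x₀) ∧
          ∀ t ∈ timesUpTo s, x x₀ t ∈ semialgSet g) ∧
        (∀ v : State n → ℝ, Integrable v μ₀ → ∫ y, v y ∂μ₀ = ∫ x₀, v (x x₀ 0) ∂μ₀) ∧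
        (∀ v : State n → ℝ, Integrable v μ → ∫ y, v y ∂μ = occupationIntegral β μ₀ τ x v) ∧
        (∀ v : State n → ℝ, Integrable v μT →
          ∫ y, v y ∂μT = terminalIntegral β μ₀ τ x v) ∧
        (∀ i, ∀ v : State n → ℝ, Integrable v (ν i) →
          ∫ y, v y ∂(ν i) = occupationIntegral β μ₀ τ x fun y => v y * u y i)) := by

  refine ⟨?_, ?_⟩
  · intro K F hF μ₀ μ μT _ _ _ hL
    obtain ⟨τ, Φ, hτ, hΦ, hocc, hter, -⟩ := exists_flow_stopping_kernel hβ hF hL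
    refine ⟨τ, fun x t => Φ t x, hτ, fun x₀ => ⟨Φ.map_zero_apply x₀, fun t _ =>
      (hΦ x₀ t).hasDerivWithinAt⟩, fun v _ => ?_, hocc, hter⟩
    simp only [Φ.map_zero_apply]
  · intro m k f fu g ubar K u hcomp hu hbox μ₀ μ μT _ _ _ ν _ hμ _ hν hL
    have hclosed := isClosed_semialgSet g
    -- Two extensions: `u` to a Lipschitz `U` on the whole space, then the closed loop from `X` to a
    -- globally Lipschitz `F`, as polynomial growth may prevent the former from being enough. Values
    -- off `X` are irrelevant since `μ` gives that region no mass.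
    obtain ⟨U, hU, hUu⟩ := hu.extend_finite_dimension
    obtain ⟨K', hK'⟩ := exists_lipschitzOnWith_closedLoop f fu hU hcomp
    obtain ⟨F, hF, hFU⟩ := hK'.extend_finite_dimension
    have hμX : ∀ᵐ x ∂μ, x ∈ semialgSet g := mem_of_superset Measure.support_mem_ae hμ
    have hloop : ∀ x ∈ semialgSet g, F x = closedLoop f fu u x := fun x hx => by
      rw [← hFU hx, closedLoop, closedLoop, hUu hx]
    have hpos : ∀ᵐ x ∂μ, ∀ i, 0 ≤ U x i := by
      filter_upwards [hμX] with x hx i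
      rw [← hUu hx]
      exact (hbox hx i).1
    have hνU : ∀ i, ν i = μ.withDensity fun x => ENNReal.ofReal (U x i) := by
      intro i
      rw [hν i]
      refine withDensity_congr_ae ?_
      filter_upwards [hμX] with x hx
      rw [hUu hx]
    have hL' : ∀ v : State n → ℝ, ContDiff ℝ 1 v → HasCompactSupport v →
        ∫ x, v x ∂μT = (∫ x, v x ∂μ₀) + ∫ x, (fderiv ℝ v x (F x) - β * v x) ∂μ := by
      intro v hv hvc
      rw [hL v hv, add_assoc, ← liouville_of_control (fu := fu) hU.continuous
        (hμX.mono fun x hx => (hFU hx).symm) hpos hv hvc]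
      simp_rw [hνU]
    obtain ⟨τ, Φ, hτ, hΦ, hocc, hter, hae⟩ := exists_flow_stopping_kernel hβ hF hL'
    have hexit := hae (semialgSet g)ᶜ hμX
    simp only [mem_compl_iff, not_not] at hexit
    -- Viability is claimed for every initial point of `X`, but is known only `μ₀`-almost
    -- everywhere. On a measurable null set `N` containing the bad points the law is replaced by
    -- stopping at time `0`, where viability is trivial and no integral changes.
    obtain ⟨N, hNsub, hNm, hN0⟩ := exists_measurable_superset_of_null (ae_iff.1 hexit)
    have hgood : ∀ x ∉ N, ∀ᵐ s ∂(τ x), ∀ᵐ t ∂(volume.restrict (timesUpTo s)),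
        Φ t x ∈ semialgSet g := fun x hx => by_contra fun h => hx (hNsub h)
    have hNae : ∀ᵐ x ∂μ₀, x ∉ N := measure_eq_zero_iff_ae_notMem.1 hN0
    classical
    let τ' : Kernel (State n) ℝ≥0∞ := Kernel.piecewise hNm (Kernel.const _ (Measure.dirac 0)) τ
    have hτN : ∀ x ∈ N, τ' x = Measure.dirac 0 := fun x hx => by
      simp [τ', Kernel.piecewise_apply, hx]
    have hττ' : ∀ x ∉ N, τ' x = τ x := fun x hx => by
      simp [τ', Kernel.piecewise_apply, hx]
    have hocc' : ∀ v : State n → ℝ, Integrable v μ →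
        ∫ y, v y ∂μ = occupationIntegral β μ₀ τ' (fun x t => Φ t x) v := by
      intro v hv
      rw [hocc v hv]
      refine integral_congr_ae ?_
      filter_upwards [hNae] with x hx
      rw [hττ' x hx]
    refine ⟨τ', fun x t => Φ t x, inferInstance, fun x₀ hx₀ => ⟨Φ.map_zero_apply x₀,
      fun s hs => ?_⟩, fun v _ => by simp only [Φ.map_zero_apply], hocc', fun v hv => ?_,
      fun i v hv => ?_⟩
    · have hstay : ∀ t ∈ timesUpTo s, Φ t x₀ ∈ semialgSet g := by
        have h0 : Φ 0 x₀ ∈ semialgSet g := by rwa [Φ.map_zero_apply]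
        by_cases hx : x₀ ∈ N
        · rw [hτN x₀ hx] at hs
          have hs0 : s = 0 := Measure.support_subset_of_isClosed (isClosed_singleton (x := 0))
            (by simp) hs
          intro t ht
          rw [hs0, timesUpTo_of_ne_top ENNReal.zero_ne_top, ENNReal.toReal_zero, Icc_self] at ht
          rwa [mem_singleton_iff.1 ht]
        · rw [hττ' x₀ hx] at hs
          exact forall_mem_of_ae_timesUpTo (y := fun t => Φ t x₀)
            (Φ.continuous continuous_id continuous_const) hclosed h0 (hgood x₀ hx) s hs
      refine ⟨⟨Φ.map_zero_apply x₀, fun t ht => ?_⟩, hstay⟩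
      rw [← hloop _ (hstay t ht)]
      exact (hΦ x₀ t).hasDerivWithinAt
    · rw [hter v hv]
      refine integral_congr_ae ?_
      filter_upwards [hNae] with x hx
      rw [hττ' x hx]
    · have hUm : Measurable fun x => ENNReal.ofReal (U x i) := by
        have := hU.continuous
        exact (Continuous.measurable (by fun_prop : Continuous fun x => U x i)).ennreal_ofReal
      have hfin : ∀ᵐ x ∂μ, ENNReal.ofReal (U x i) < ∞ :=
        Eventually.of_forall fun _ => ENNReal.ofReal_lt_top
      -- The identity for `ν i` is the one for `μ` applied to `v * u_i`.
      have heq : (fun x => (ENNReal.ofReal (U x i)).toReal • v x) =ᵐ[μ] fun x => v x * u x i := by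
        filter_upwards [hμX] with x hx
        rw [← hUu hx, ENNReal.toReal_ofReal (hbox hx i).1, smul_eq_mul, mul_comm]
      rw [hνU i] at hv ⊢
      rw [integral_withDensity_eq_integral_toReal_smul hUm hfin, integral_congr_ae heq]
      exact hocc' _ (((integrable_withDensity_iff_integrable_smul' hUm hfin).1 hv).congr heq)
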